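/- Let $(R,\mathfrak m)$ be a commutative Noetherian Cohen–Macaulay local ring of dimension $d>0$ and of prime characteristic $p>0$. For $n\ge 0$ write $q=p^n$, let ${}^{f^n}\!R$ denote $R$ viewed as an $R$-module via the $n$-th iterate $f^n\colon r\mapsto r^{q}$ of the Frobenius endomorphism, and let $F^n(N)=N\otimes_R{}^{f^n}\!R$ be the base change of an $R$-module $N$ along $f^n$, with $R$-module structure given by multiplication on the right-hand factor. For an ideal $I$ let $I^{[q]}$ be the ideal generated by the $q$-th powers of the elements of $I$, and put $$\kappa(R)=\min\{t\ge 0 : \mathfrak m^{[p^t]}\subseteq(\mathbf y)\text{ for some system of parameters }\mathbf y\text{ of }R\}.$$ Let $\ell$ denote length. Let $M$ be a finitely generated maximal Cohen–Macaulay $R$-module (that is, $M\neq 0$ and $\operatorname{depth}M=d$) which has a rank (that is, $M\otimes_R Q$ is a free $Q$-module of finite rank, where $Q$ is the total ring of fractions of $R$), and let $\mathbf x=x_1,\dots,x_d$ be any system of parameters of $R$. Then the following are equivalent: (1) $M$ is free; (2) $\ell(F^n(M/\mathbf xM))=q^d\,\ell(M/\mathbf xM)$ for one $n\ge\kappa(R)$;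 (2') $\ell(F^n(M/\mathbf xM))=q^d\,\ell(M/\mathbf xM)$ for all $n\ge 0$; (3) $\operatorname{Tor}_i^R(M/\mathbf xM,{}^{f^n}\!R)=0$ for all $i>0$ and all $n>0$; (4) $\operatorname{Tor}_i^R(M/\mathbf xM,{}^{f^n}\!R)=0$ for one $i>0$ and one $n\ge\kappa(R)$. Moreover, $M/\mathbf xM$ is rigid against Frobenius: either it has finite projective dimension over $R$, or there is an $n_0$ such that $\operatorname{Tor}_i^R(M/\mathbf xM,{}^{f^n}\!R)\neq 0$ for all $n\ge n_0$ and all $i\ge 0$. -/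

import Mathlib

open CategoryTheory IsLocalRing

universe u

namespace FrobeniusFreeness

noncomputable section

/-- The depth of a module over a local ring: the supremum of the lengths of the
`M`-regular sequences contained in the maximal ideal. -/
def depth (R : Type u) [CommRing R] [IsLocalRing R]
    (M : Type u) [AddCommGroup M] [Module R M] : ℕ∞ :=
  ⨆ (rs : List R) (_ : RingTheory.Sequence.IsRegular M rs ∧ ∀ r ∈ rs, r ∈ maximalIdeal R),
    (rs.length : ℕ∞)

/-- A Noetherian local ring is Cohen-Macaulay if its depth equals its Krull dimension. -/
def IsCohenMacaulayLocal (R : Type u) [CommRing R] [IsLocalRing R] : Prop :=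
  (depth R R : WithBot ℕ∞) = ringKrullDim R

/-- A (finitely generated) module over a Noetherian local ring `R` is maximal Cohen-Macaulay if
it is nonzero and its depth equals the Krull dimension of `R`. -/
structure IsMaximalCohenMacaulay (R : Type u) [CommRing R] [IsLocalRing R]
    (M : Type u) [AddCommGroup M] [Module R M] : Prop where
  nontrivial : Nontrivial M
  depth_eq : (depth R M : WithBot ℕ∞) = ringKrullDim R

/-- `M` has a rank: over the total ring of fractions `Q` of `R`, the localization of `M` at the
set of nonzerodivisors of `R` is free of some rank `r`. -/
def HasRank (R : Type u) [CommRing R] (M : Type u) [AddCommGroup M] [Module R M] : Prop :=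
  ∃ r : ℕ, Nonempty (LocalizedModule (nonZeroDivisors R) M ≃ₗ[Localization (nonZeroDivisors R)]
    (Fin r → Localization (nonZeroDivisors R)))

/-- A (full) system of parameters of a local ring of dimension `d`: a sequence of `d` elements
generating an ideal whose radical is the maximal ideal. -/
structure IsSystemOfParameters {R : Type u} [CommRing R] [IsLocalRing R] {d : ℕ}
    (x : Fin d → R) : Prop where
  dim_eq : ringKrullDim R = d
  radical_eq : (Ideal.span (Set.range x)).radical = maximalIdeal R

/-- The quotient module `M / xM`. -/
abbrev QuotientBy {R : Type u} [CommRing R] {d : ℕ} (x : Fin d → R)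
    (M : Type u) [AddCommGroup M] [Module R M] : Type u :=
  M ⧸ (Ideal.span (Set.range x) • (⊤ : Submodule R M))

section Frobenius

variable {R : Type u} [CommRing R] (p : ℕ) [ExpChar R p]

/-- The Frobenius power `I^[p^t]`: the ideal generated by the `p^t`-th powers of the elements
(equivalently, of any set of generators) of `I`. -/
def frobeniusPower (t : ℕ) (I : Ideal R) : Ideal R :=
  Ideal.span ((fun r : R => r ^ p ^ t) '' (I : Set R))

variable (R) in
/-- `κ(R)`: the least `t` such that `𝔪^[p^t]` is contained in the ideal generated by
some system of parameters of `R`. -/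
def kappa [IsLocalRing R] : ℕ :=
  sInf {t : ℕ | ∃ (d : ℕ) (x : Fin d → R), IsSystemOfParameters x ∧
    frobeniusPower p t (maximalIdeal R) ≤ Ideal.span (Set.range x)}

/-- The Frobenius functor `F^n`: base change along the `n`-th iterate of the Frobenius
endomorphism `r ↦ r ^ p`, the module structure being that of the target of the base change. -/
def frobeniusFunctor (n : ℕ) : ModuleCat.{u} R ⥤ ModuleCat.{u} R :=
  ModuleCat.extendScalars (iterateFrobenius R p n)

variable (R) in
/-- The `R`-module `R` with structure `r • s = r ^ p ^ n * s`, i.e. `R` restricted along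
the `n`-th iterate of Frobenius. -/
def frobeniusModule (n : ℕ) : ModuleCat.{u} R :=
  (ModuleCat.restrictScalars (iterateFrobenius R p n)).obj (ModuleCat.of R R)

/-- `Tor_i^R(N, R)`, where the second argument is `R` regarded as a module via the `n`-th iterate
of Frobenius (the `i`-th left derived functor of `N ↦ N ⊗ frobeniusModule R p n`). -/
def frobeniusTor (i n : ℕ) (N : ModuleCat.{u} R) : ModuleCat.{u} R :=
  ((Tor' (ModuleCat.{u} R) i).obj N).obj (frobeniusModule R p n)

/-- `N` is rigid against Frobenius: either `N` has finite projective dimension, or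
the modules `Tor_i(N, R)` along the `n`-th iterate of Frobenius are nonzero
for all `i` and all sufficiently large `n`. -/
def RigidAgainstFrobenius (N : ModuleCat.{u} R) : Prop :=
  projectiveDimension N < ⊤ ∨
    ∃ n₀ : ℕ, ∀ n ≥ n₀, ∀ i : ℕ, ¬ Limits.IsZero (frobeniusTor p i n N)

end Frobenius

end

end FrobeniusFreeness

namespace FrobeniusFreeness

open RingTheory.Sequence
open scoped Pointwise

section RegularSequences

variable {R : Type*} [CommRing R]
variable {T F D : Type*} [AddCommGroup T] [Module R T] [AddCommGroup F] [Module R F]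
  [AddCommGroup D] [Module R D]

/-- Reduction modulo a sequence which is weakly regular on the cokernel preserves injectivity. -/
lemma mem_smul_top_of_map_mem {f : T →ₗ[R] F} {g : F →ₗ[R] D} (hf : Function.Injective f)
    (hfg : Function.Exact f g) (hg : Function.Surjective g) {rs : List R}
    (h : IsWeaklyRegular D rs) {t : T} (ht : f t ∈ Ideal.ofList rs • (⊤ : Submodule R F)) :
    t ∈ Ideal.ofList rs • (⊤ : Submodule R T) := by
  have h0 : Function.Exact (0 : (Fin 0 → R) →ₗ[R] T) f := by
    intro y
    constructor
    · intro hy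
      exact ⟨0, by simpa using (hf (hy.trans (map_zero f).symm)).symm⟩
    · rintro ⟨_, rfl⟩
      simp
  have key := map_first_exact_on_four_term_right_exact_of_isSMulRegular_last h0 hfg hg h
  have h1 := (key (Submodule.Quotient.mk t)).1 (by
    rw [Submodule.mapQ_apply, Submodule.Quotient.mk_eq_zero]
    exact ht)
  obtain ⟨y, hy⟩ := h1
  obtain ⟨y, rfl⟩ := Submodule.mkQ_surjective _ y
  rw [← Submodule.Quotient.mk_eq_zero, ← hy]
  simp

lemma quotSMulTop_map_injective {f : T →ₗ[R] F} {g : F →ₗ[R] D} (hf : Function.Injective f)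
    (hfg : Function.Exact f g) {r : R}
    (h : IsSMulRegular D r) : Function.Injective (QuotSMulTop.map r f) := by
  rw [injective_iff_map_eq_zero]
  intro t
  obtain ⟨t, rfl⟩ := Submodule.mkQ_surjective _ t
  intro ht
  rw [Submodule.mkQ_apply, QuotSMulTop.map_apply_mk, Submodule.Quotient.mk_eq_zero,
    Submodule.mem_smul_pointwise_iff_exists] at ht
  obtain ⟨y, -, hy⟩ := ht
  have hgy : g y = 0 := h (by
    simp only [smul_zero]
    rw [← map_smul, hy]
    exact hfg.apply_apply_eq_zero t)
  obtain ⟨s, rfl⟩ := (hfg y).1 hgy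
  rw [Submodule.mkQ_apply, Submodule.Quotient.mk_eq_zero,
    Submodule.mem_smul_pointwise_iff_exists]
  exact ⟨s, trivial, hf (by rw [map_smul, hy])⟩

/-- A sequence weakly regular on two modules is weakly regular on the kernel of a surjection
between them. -/
lemma isWeaklyRegular_of_exact {f : T →ₗ[R] F} {g : F →ₗ[R] D} (hf : Function.Injective f)
    (hfg : Function.Exact f g) (hg : Function.Surjective g) {rs : List R}
    (hF : IsWeaklyRegular F rs) (hD : IsWeaklyRegular D rs) : IsWeaklyRegular T rs := by
  induction rs generalizing T F D with
  | nil => exact IsWeaklyRegular.nil R T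
  | cons r rs ih =>
    rw [isWeaklyRegular_cons_iff] at hF hD ⊢
    refine ⟨hF.1.of_injective f hf, ?_⟩
    exact ih (quotSMulTop_map_injective hf hfg hD.1) (QuotSMulTop.map_exact r hfg hg)
      (QuotSMulTop.map_surjective r hg) hF.2 hD.2

lemma mk_mem_ofList_smul_top_iff (r : R) (rs : List R) (x : F) :
    (Submodule.Quotient.mk x : QuotSMulTop r F) ∈
      Ideal.ofList rs • (⊤ : Submodule R (QuotSMulTop r F)) ↔
    x ∈ Ideal.ofList (r :: rs) • (⊤ : Submodule R F) := by
  rw [← Submodule.Quotient.mk_eq_zero, ← Submodule.Quotient.mk_eq_zero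
    (Ideal.ofList (r :: rs) • (⊤ : Submodule R F)),
    ← LinearEquiv.map_eq_zero_iff (Submodule.quotOfListConsSMulTopEquivQuotSMulTopInner F r rs)]
  rfl

variable [IsLocalRing R]

lemma subsingleton_of_le_smul_top [Module.Finite R T] {I : Ideal R} (hI : I ≤ maximalIdeal R)
    (h : (⊤ : Submodule R T) ≤ I • ⊤) : Subsingleton T := by
  rw [← Submodule.subsingleton_iff R]
  refine subsingleton_of_bot_eq_top ?_
  exact (Submodule.eq_bot_of_le_smul_of_le_jacobson_bot I ⊤ Module.Finite.fg_top h
    (hI.trans (maximalIdeal_le_jacobson _))).symm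

/-- If `f` stays injective modulo a sequence in the maximal ideal which is weakly regular on the
target, then `f` is injective and the sequence is weakly regular on the cokernel. -/
lemma injective_and_isWeaklyRegular_of_injective_mod [IsNoetherianRing R] [Module.Finite R T]
    {f : T →ₗ[R] F} {g : F →ₗ[R] D}
    (hfg : Function.Exact f g) (hg : Function.Surjective g) {rs : List R}
    (hrs : ∀ r ∈ rs, r ∈ maximalIdeal R) (hF : IsWeaklyRegular F rs)
    (h : ∀ t, f t ∈ Ideal.ofList rs • (⊤ : Submodule R F) →
      t ∈ Ideal.ofList rs • (⊤ : Submodule R T)) :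
    Function.Injective f ∧ IsWeaklyRegular D rs := by
  induction rs generalizing T F D with
  | nil =>
    refine ⟨?_, IsWeaklyRegular.nil R D⟩
    rw [injective_iff_map_eq_zero]
    intro t ht
    simpa [ht] using h t
  | cons r rs ih =>
    rw [isWeaklyRegular_cons_iff] at hF ⊢
    obtain ⟨hinj, hreg⟩ := ih (QuotSMulTop.map_exact r hfg hg) (QuotSMulTop.map_surjective r hg)
      (fun s hs => hrs s (List.mem_cons_of_mem r hs)) hF.2 (by
        intro t ht
        obtain ⟨t, rfl⟩ := Submodule.mkQ_surjective _ t
        rw [Submodule.mkQ_apply, QuotSMulTop.map_apply_mk, mk_mem_ofList_smul_top_iff] at ht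
        rw [Submodule.mkQ_apply, mk_mem_ofList_smul_top_iff]
        exact h t ht)
    have hmem : ∀ t, f t ∈ r • (⊤ : Submodule R F) → t ∈ r • (⊤ : Submodule R T) := by
      intro t ht
      rw [← Submodule.Quotient.mk_eq_zero] at ht ⊢
      exact hinj (by rw [QuotSMulTop.map_apply_mk, ht, map_zero])
    have hker : LinearMap.ker f = ⊥ := by
      refine Submodule.eq_bot_of_le_smul_of_le_jacobson_bot (Ideal.span {r}) _
        (IsNoetherian.noetherian _) ?_
        ((Ideal.span_singleton_le_iff_mem _).2
          (maximalIdeal_le_jacobson _ (hrs r List.mem_cons_self)))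
      intro t ht
      have h0 : f t = 0 := ht
      obtain ⟨s, -, rfl⟩ := (Submodule.mem_smul_pointwise_iff_exists _ _ _).1
        (hmem t (by rw [h0]; exact Submodule.zero_mem _))
      rw [Submodule.ideal_span_singleton_smul]
      refine Submodule.smul_mem_pointwise_smul _ _ _ ?_
      exact hF.1 (by simpa using h0)
    have hf : Function.Injective f := LinearMap.ker_eq_bot.1 hker
    refine ⟨hf, ?_, hreg⟩
    rw [isSMulRegular_iff_right_eq_zero_of_smul]
    intro y hy
    obtain ⟨y, rfl⟩ := hg y
    rw [← map_smul] at hy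
    obtain ⟨t, ht⟩ := (hfg _).1 hy
    obtain ⟨s, -, rfl⟩ := (Submodule.mem_smul_pointwise_iff_exists _ _ _).1
      (hmem t (by rw [ht]; exact Submodule.smul_mem_pointwise_smul _ _ _ trivial))
    rw [map_smul] at ht
    rw [← hF.1 ht]
    exact hfg.apply_apply_eq_zero s

end RegularSequences

section SystemsOfParameters

variable {R : Type*} [CommRing R]

lemma annihilator_sup_le_annihilator_quotient (N : Type*) [AddCommGroup N] [Module R N]
    (I : Ideal R) :
    Module.annihilator R N ⊔ I ≤ Module.annihilator R (N ⧸ (I • ⊤ : Submodule R N)) := by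
  refine sup_le ?_ ?_
  · exact LinearMap.annihilator_le_of_surjective _ (Submodule.mkQ_surjective _)
  · intro c hc
    rw [Module.mem_annihilator]
    intro x
    obtain ⟨x, rfl⟩ := Submodule.mkQ_surjective _ x
    rw [← map_smul, Submodule.mkQ_apply, Submodule.Quotient.mk_eq_zero]
    exact Submodule.smul_mem_smul hc trivial

variable [IsLocalRing R]

lemma isSMulRegular_of_maximalIdeal_le_radical {N : Type*} [AddCommGroup N] [Module R N]
    {a b : R} (ha : IsSMulRegular N a) (hma : a ∈ maximalIdeal R)
    (hb : maximalIdeal R ≤ (Module.annihilator R N ⊔ Ideal.span {b}).radical) :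
    IsSMulRegular N b := by
  rw [isSMulRegular_iff_right_eq_zero_of_smul]
  intro x hx
  obtain ⟨k, hk⟩ := hb hma
  have hle : Module.annihilator R N ⊔ Ideal.span {b} ≤ LinearMap.ker (LinearMap.toSpanSingleton R N x) := by
    refine sup_le ?_ ((Ideal.span_singleton_le_iff_mem _).2 hx)
    intro c hc
    exact Module.mem_annihilator.1 hc x
  have h0 : a ^ k • x = 0 := hle hk
  exact (ha.pow k).right_eq_zero_of_smul h0

lemma maximalIdeal_le_of_prime_lt [IsNoetherianRing R] {P P' : Ideal R} [P.IsPrime]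
    [P'.IsPrime] (hPP' : P < P') {a : R} (ha : a ∈ maximalIdeal R)
    (h : maximalIdeal R ≤ (P ⊔ Ideal.span {a}).radical) : maximalIdeal R ≤ P' := by
  by_contra hne
  have hP'm : P' < maximalIdeal R :=
    lt_of_le_not_ge (le_maximalIdeal Ideal.IsPrime.ne_top') hne
  have hPm : P ≤ maximalIdeal R := hPP'.le.trans hP'm.le
  have hmin : maximalIdeal R ∈ (P ⊔ Ideal.span {a}).minimalPrimes := by
    refine ⟨⟨inferInstance, sup_le hPm ((Ideal.span_singleton_le_iff_mem _).2 ha)⟩, ?_⟩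
    rintro Q ⟨hQ, hQle⟩ -
    exact h.trans ((hQ.radical_le_iff).2 hQle)
  have hht := Ideal.map_height_le_one_of_mem_minimalPrimes hmin
  have hs : Function.Surjective (Ideal.Quotient.mk P) := Ideal.Quotient.mk_surjective
  have key : ∀ Q : Ideal R, P ≤ Q → Ideal.comap (Ideal.Quotient.mk P) (Q.map (Ideal.Quotient.mk P)) = Q := by
    intro Q hQ
    rw [Ideal.comap_map_of_surjective' _ hs, Ideal.mk_ker, sup_eq_left.2 hQ]
  have hp : ∀ Q : Ideal R, Q.IsPrime → P ≤ Q → (Q.map (Ideal.Quotient.mk P)).IsPrime := by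
    intro Q hQ hPQ
    exact Ideal.map_isPrime_of_surjective hs (by rwa [Ideal.mk_ker])
  have := hp P' inferInstance hPP'.le
  have := hp (maximalIdeal R) inferInstance hPm
  have l1 : (P.map (Ideal.Quotient.mk P)) < P'.map (Ideal.Quotient.mk P) := by
    refine lt_of_le_of_ne (Ideal.map_mono hPP'.le) fun h => hPP'.ne ?_
    rw [← key P le_rfl, h, key P' hPP'.le]
  have l2 : (P'.map (Ideal.Quotient.mk P)) < (maximalIdeal R).map (Ideal.Quotient.mk P) := by
    refine lt_of_le_of_ne (Ideal.map_mono hP'm.le) fun h => hP'm.ne ?_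
    rw [← key P' hPP'.le, h, key _ hPm]
  have := hp P inferInstance le_rfl
  have e1 := Ideal.height_strict_mono_of_isPrime l1
  have e2 := Ideal.height_strict_mono_of_isPrime l2
  have e3 := lt_of_lt_of_le e2 hht
  rw [Order.lt_one_iff] at e3
  rw [e3] at e1
  exact not_lt_zero e1

lemma maximalIdeal_le_radical_of_notMem_minimalPrimes [IsNoetherianRing R] {I : Ideal R} {a z : R}
    (ha : a ∈ maximalIdeal R) (h : maximalIdeal R ≤ (I ⊔ Ideal.span {a}).radical)
    (hz : ∀ P ∈ I.minimalPrimes, P ≠ maximalIdeal R → z ∉ P) :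
    maximalIdeal R ≤ (I ⊔ Ideal.span {z}).radical := by
  rw [Ideal.radical_eq_sInf]
  refine le_sInf ?_
  rintro P' ⟨hP', hprime⟩
  obtain ⟨P, hP, hPP'⟩ := Ideal.exists_minimalPrimes_le (le_sup_left.trans hP')
  have : P.IsPrime := hP.1.1
  by_cases hPm : P = maximalIdeal R
  · exact hPm ▸ hPP'
  · have hzP := hz P hP hPm
    have hzP' : z ∈ P' := hP' (Ideal.mem_sup_right (Ideal.mem_span_singleton_self z))
    have hlt : P < P' := lt_of_le_of_ne hPP' fun h => hzP (h ▸ hzP')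
    exact maximalIdeal_le_of_prime_lt hlt ha
      (h.trans (Ideal.radical_mono (sup_le_sup_right hP.1.2 _)))

/-- Prime avoidance: two one-dimensional quotients have a common parameter. -/
lemma exists_common_parameter [IsNoetherianRing R] {I J : Ideal R} {a b : R}
    (ha : a ∈ maximalIdeal R) (hb : b ∈ maximalIdeal R)
    (hI : maximalIdeal R ≤ (I ⊔ Ideal.span {a}).radical)
    (hJ : maximalIdeal R ≤ (J ⊔ Ideal.span {b}).radical) :
    ∃ z ∈ maximalIdeal R, maximalIdeal R ≤ (I ⊔ Ideal.span {z}).radical ∧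
      maximalIdeal R ≤ (J ⊔ Ideal.span {z}).radical := by
  classical
  have hfin : ((I.minimalPrimes ∪ J.minimalPrimes) \ {maximalIdeal R}).Finite :=
    ((Ideal.finite_minimalPrimes_of_isNoetherianRing R I).union
      (Ideal.finite_minimalPrimes_of_isNoetherianRing R J)).subset Set.sdiff_subset
  have hprime : ∀ P ∈ hfin.toFinset, P.IsPrime := by
    intro P hP
    rw [Set.Finite.mem_toFinset] at hP
    exact hP.1.elim (fun h => h.1.1) (fun h => h.1.1)
  have hnot : ¬ ((maximalIdeal R : Set R) ⊆ ⋃ P ∈ (hfin.toFinset : Set (Ideal R)), (P : Set R)) := by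
    rw [Ideal.subset_union_prime (f := fun P : Ideal R => P) ⊥ ⊥ (fun P hP _ _ => hprime P hP)]
    rintro ⟨P, hP, hle⟩
    have := hprime P hP
    rw [Set.Finite.mem_toFinset] at hP
    exact hP.2 (le_antisymm (le_maximalIdeal Ideal.IsPrime.ne_top') hle)
  obtain ⟨z, hz, hzn⟩ := Set.not_subset.1 hnot
  have hzn' : ∀ P ∈ I.minimalPrimes ∪ J.minimalPrimes, P ≠ maximalIdeal R → z ∉ P := by
    intro P hP hPm hzP
    refine hzn (Set.mem_biUnion (x := P) ?_ hzP)
    simpa using ⟨hP, hPm⟩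
  exact ⟨z, hz,
    maximalIdeal_le_radical_of_notMem_minimalPrimes ha hI fun P hP => hzn' P (Or.inl hP),
    maximalIdeal_le_radical_of_notMem_minimalPrimes hb hJ fun P hP => hzn' P (Or.inr hP)⟩

lemma isWeaklyRegular_exchange_last {N : Type*} [AddCommGroup N] [Module R N]
    {as : List R} {a b : R} (h : IsWeaklyRegular N (as ++ [a])) (ha : a ∈ maximalIdeal R)
    (hb : maximalIdeal R ≤ (Module.annihilator R N ⊔ Ideal.ofList as ⊔ Ideal.span {b}).radical) :
    IsWeaklyRegular N (as ++ [b]) := by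
  rw [isWeaklyRegular_append_iff, isWeaklyRegular_singleton_iff] at h ⊢
  refine ⟨h.1, isSMulRegular_of_maximalIdeal_le_radical h.2 ha ?_⟩
  exact hb.trans (Ideal.radical_mono
    (sup_le_sup_right (annihilator_sup_le_annihilator_quotient N _) _))

/-- If one system of parameters of a finite module is a regular sequence, then so is any other. -/
theorem isWeaklyRegular_of_maximalIdeal_le_radical [IsNoetherianRing R] (n : ℕ)
    {N : Type*} [AddCommGroup N] [Module R N] [Module.Finite R N] {as bs : List R}
    (hal : as.length = n) (hbl : bs.length = n)
    (ham : ∀ a ∈ as, a ∈ maximalIdeal R) (hbm : ∀ b ∈ bs, b ∈ maximalIdeal R)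
    (ha : maximalIdeal R ≤ (Module.annihilator R N ⊔ Ideal.ofList as).radical)
    (hb : maximalIdeal R ≤ (Module.annihilator R N ⊔ Ideal.ofList bs).radical)
    (h : IsWeaklyRegular N as) : IsWeaklyRegular N bs := by
  induction n generalizing N as bs with
  | zero =>
    rw [List.length_eq_zero_iff.1 hbl]
    exact IsWeaklyRegular.nil R N
  | succ n ih =>
    obtain ⟨as, a, rfl⟩ := (List.eq_nil_or_concat' as).resolve_left (by rintro rfl; simp at hal)
    obtain ⟨bs, b, rfl⟩ := (List.eq_nil_or_concat' bs).resolve_left (by rintro rfl; simp at hbl)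
    simp only [List.length_append, List.length_cons, List.length_nil, zero_add,
      Nat.add_right_cancel_iff] at hal hbl
    simp only [List.mem_append, List.mem_singleton, or_imp, forall_and, forall_eq] at ham hbm
    rw [Ideal.ofList_append, Ideal.ofList_singleton, ← sup_assoc] at ha hb
    obtain ⟨z, hz, hza, hzb⟩ := exists_common_parameter ham.2 hbm.2 ha hb
    have h1 := isWeaklyRegular_exchange_last h ham.2 hza
    have h2 : IsWeaklyRegular N (z :: as) :=
      isWeaklyRegular_of_perm_of_subset_maximalIdeal h1 (List.perm_append_singleton z as) (by
        simp only [List.mem_append, List.mem_singleton, or_imp, forall_and, forall_eq]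
        exact ⟨ham.1, hz⟩)
    rw [isWeaklyRegular_cons_iff] at h2
    have hle : ∀ l : List R, Module.annihilator R N ⊔ Ideal.ofList l ⊔ Ideal.span {z} ≤
        Module.annihilator R (QuotSMulTop z N) ⊔ Ideal.ofList l := by
      intro l
      rw [sup_right_comm]
      refine sup_le_sup_right ?_ _
      exact sup_le (LinearMap.annihilator_le_of_surjective _ (Submodule.mkQ_surjective _))
        ((Ideal.span_singleton_le_iff_mem _).2 (QuotSMulTop.mem_annihilator N z))
    have h3 := ih hal hbl ham.1 hbm.1 (hza.trans (Ideal.radical_mono (hle as)))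
      (hzb.trans (Ideal.radical_mono (hle bs))) h2.2
    have h4 : IsWeaklyRegular N (z :: bs) := (isWeaklyRegular_cons_iff N z bs).2 ⟨h2.1, h3⟩
    have h5 : IsWeaklyRegular N (bs ++ [z]) :=
      isWeaklyRegular_of_perm_of_subset_maximalIdeal h4 (List.perm_append_singleton z bs).symm (by
        simp only [List.mem_cons, forall_eq_or_imp]
        exact ⟨hz, hbm.1⟩)
    exact isWeaklyRegular_exchange_last h5 hz hb

/-- If a finite module has a regular sequence of length `dim R` in the maximal ideal, then every
system of parameters of `R` is a regular sequence on it. -/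
theorem isWeaklyRegular_of_depth_eq [IsNoetherianRing R] {d : ℕ} (hdim : ringKrullDim R = d)
    {N : Type*} [AddCommGroup N] [Module R N] [Module.Finite R N] {as bs : List R}
    (hal : as.length = d) (hbl : bs.length = d)
    (ham : ∀ a ∈ as, a ∈ maximalIdeal R) (hbm : ∀ b ∈ bs, b ∈ maximalIdeal R)
    (hb : maximalIdeal R ≤ (Ideal.ofList bs).radical)
    (h : IsWeaklyRegular N as) : IsWeaklyRegular N bs := by
  refine isWeaklyRegular_of_maximalIdeal_le_radical d hal hbl ham hbm ?_
    (hb.trans (Ideal.radical_mono le_sup_right)) h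
  rcases subsingleton_or_nontrivial N with hN | hN
  · rw [Module.annihilator_eq_top_iff.2 hN, top_sup_eq, Ideal.radical_top]
    exact le_top
  have hreg := IsRegular.of_isWeaklyRegular_of_mem_maximalIdeal N ham h
  have hQ : Nontrivial (N ⧸ Ideal.ofList as • (⊤ : Submodule R N)) :=
    Submodule.Quotient.nontrivial_iff.2 hreg.top_ne_smul.symm
  have h1 := Module.supportDim_add_length_eq_supportDim_of_isRegular as hreg
  have h2 := Module.supportDim_le_ringKrullDim R N
  have h3 : Module.supportDim R (N ⧸ Ideal.ofList as • (⊤ : Submodule R N)) = 0 := by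
    have h4 := Module.supportDim_ne_bot_of_nontrivial R (N ⧸ Ideal.ofList as • (⊤ : Submodule R N))
    rw [← h1, hdim, hal] at h2
    generalize Module.supportDim R (N ⧸ Ideal.ofList as • (⊤ : Submodule R N)) = e at h2 h4
    induction e with
    | bot => exact absurd rfl h4
    | coe e =>
      induction e with
      | top => exact absurd h2 (not_le_of_gt (by exact_mod_cast (ENat.natCast_lt_top d)))
      | coe e =>
        norm_cast at h2 ⊢
        omega
  have h5 := support_of_supportDim_eq_zero R _ h3
  rw [Module.support_quotient, Module.support_eq_zeroLocus, ← PrimeSpectrum.zeroLocus_sup] at h5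
  have h6 := (PrimeSpectrum.zeroLocus_eq_iff).1 h5
  rw [h6]
  exact Ideal.le_radical

end SystemsOfParameters

section Length

variable {R : Type*} [CommRing R] {K : Type*} [AddCommGroup K] [Module R K]

/-- Multiplication by `r` as a map `K / (N + sK) → K / (N + rsK)`. -/
def mulQuot (N : Submodule R K) (r s : R) :
    (K ⧸ (N ⊔ s • (⊤ : Submodule R K))) →ₗ[R] K ⧸ (N ⊔ (r * s) • (⊤ : Submodule R K)) :=
  Submodule.mapQ _ _ (LinearMap.lsmul R K r) (by
    refine sup_le ?_ ?_
    · intro x hx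
      exact Submodule.mem_sup_left (N.smul_mem r hx)
    · intro x hx
      obtain ⟨y, -, rfl⟩ := (Submodule.mem_smul_pointwise_iff_exists _ _ _).1 hx
      refine Submodule.mem_sup_right ?_
      rw [LinearMap.lsmul_apply, smul_smul]
      exact Submodule.smul_mem_pointwise_smul _ _ _ trivial)

lemma mulQuot_mk (N : Submodule R K) (r s : R) (x : K) :
    mulQuot N r s (Submodule.Quotient.mk x) = Submodule.Quotient.mk (r • x) := rfl

lemma length_add_eq_length_ker_add (N : Submodule R K) (r s : R) :
    Module.length R (K ⧸ (N ⊔ s • (⊤ : Submodule R K))) +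
      Module.length R (K ⧸ (N ⊔ r • (⊤ : Submodule R K))) =
    Module.length R (LinearMap.ker (mulQuot N r s)) +
      Module.length R (K ⧸ (N ⊔ (r * s) • (⊤ : Submodule R K))) := by
  have hle : N ⊔ (r * s) • (⊤ : Submodule R K) ≤ N ⊔ r • (⊤ : Submodule R K) := by
    refine sup_le_sup_left ?_ _
    intro x hx
    obtain ⟨y, -, rfl⟩ := (Submodule.mem_smul_pointwise_iff_exists _ _ _).1 hx
    rw [mul_smul]
    exact Submodule.smul_mem_pointwise_smul _ _ _ trivial
  have h1 := Module.length_eq_add_of_exact (LinearMap.ker (mulQuot N r s)).subtype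
    (mulQuot N r s).rangeRestrict (Submodule.subtype_injective _)
    (LinearMap.surjective_rangeRestrict _) (by
      rw [LinearMap.exact_iff, LinearMap.ker_rangeRestrict, Submodule.range_subtype])
  have h2 := Module.length_eq_add_of_exact (LinearMap.range (mulQuot N r s)).subtype
    (Submodule.factor hle) (Submodule.subtype_injective _)
    (Submodule.factor_surjective hle) (by
      rw [LinearMap.exact_iff, Submodule.range_subtype]
      apply le_antisymm
      · intro x hx
        obtain ⟨x, rfl⟩ := Submodule.mkQ_surjective _ x
        have hx' : x ∈ N ⊔ r • (⊤ : Submodule R K) :=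
          (Submodule.Quotient.mk_eq_zero _).1 hx
        obtain ⟨a, ha, b, hb, rfl⟩ := Submodule.mem_sup.1 hx'
        obtain ⟨y, -, rfl⟩ := (Submodule.mem_smul_pointwise_iff_exists _ _ _).1 hb
        refine ⟨Submodule.Quotient.mk y, ?_⟩
        rw [mulQuot_mk, Submodule.mkQ_apply, eq_comm, Submodule.Quotient.eq, add_sub_cancel_right]
        exact Submodule.mem_sup_left ha
      · rintro _ ⟨y, rfl⟩
        obtain ⟨y, rfl⟩ := Submodule.mkQ_surjective _ y
        rw [LinearMap.mem_ker, Submodule.mkQ_apply, mulQuot_mk]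
        refine (Submodule.Quotient.mk_eq_zero _).2 (Submodule.mem_sup_right ?_)
        exact Submodule.smul_mem_pointwise_smul _ _ _ trivial)
  rw [h1, h2, add_assoc]

lemma length_quotient_sup_pow_le (N : Submodule R K) (r : R) (a : ℕ) :
    Module.length R (K ⧸ (N ⊔ r ^ a • (⊤ : Submodule R K))) ≤
      a * Module.length R (K ⧸ (N ⊔ r • (⊤ : Submodule R K))) := by
  induction a with
  | zero =>
    have : Subsingleton (K ⧸ (N ⊔ r ^ 0 • (⊤ : Submodule R K))) := by
      rw [Submodule.Quotient.subsingleton_iff, pow_zero, one_smul, sup_top_eq]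
    simp
  | succ a ih =>
    have h := length_add_eq_length_ker_add N r (r ^ a)
    rw [pow_succ']
    calc _ ≤ _ := le_add_self
      _ = _ := h.symm
      _ ≤ _ := add_le_add_left ih _
      _ = _ := by push_cast; ring

lemma length_quotient_sup_pow_eq (N : Submodule R K) (r : R) (hr : IsSMulRegular (K ⧸ N) r)
    (a : ℕ) :
    Module.length R (K ⧸ (N ⊔ r ^ a • (⊤ : Submodule R K))) =
      a * Module.length R (K ⧸ (N ⊔ r • (⊤ : Submodule R K))) := by
  induction a with
  | zero =>
    have : Subsingleton (K ⧸ (N ⊔ r ^ 0 • (⊤ : Submodule R K))) := by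
      rw [Submodule.Quotient.subsingleton_iff, pow_zero, one_smul, sup_top_eq]
    simp
  | succ a ih =>
    have h := length_add_eq_length_ker_add N r (r ^ a)
    have hker : LinearMap.ker (mulQuot N r (r ^ a)) = ⊥ := by
      rw [LinearMap.ker_eq_bot']
      intro x hx
      obtain ⟨x, rfl⟩ := Submodule.mkQ_surjective _ x
      rw [Submodule.mkQ_apply, mulQuot_mk, Submodule.Quotient.mk_eq_zero] at hx
      obtain ⟨n, hn, b, hb, hxy⟩ := Submodule.mem_sup.1 hx
      obtain ⟨y, -, rfl⟩ := (Submodule.mem_smul_pointwise_iff_exists _ _ _).1 hb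
      have h1 : x - r ^ a • y ∈ N := by
        refine mem_of_isSMulRegular_quotient_of_smul_mem hr ?_
        rw [smul_sub, smul_smul, ← hxy, add_sub_cancel_right]
        exact hn
      rw [Submodule.mkQ_apply, Submodule.Quotient.mk_eq_zero, ← sub_add_cancel x (r ^ a • y)]
      exact add_mem (Submodule.mem_sup_left h1)
        (Submodule.mem_sup_right (Submodule.smul_mem_pointwise_smul _ _ _ trivial))
    rw [hker, Module.length_bot, zero_add, ih] at h
    rw [pow_succ', ← h]
    push_cast
    ring

lemma length_quotient_sup_ofList_pow_le (N : Submodule R K) (rs : List R) (m : ℕ) :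
    Module.length R (K ⧸ (N ⊔ Ideal.ofList (rs.map (· ^ m)) • (⊤ : Submodule R K))) ≤
      (m ^ rs.length : ℕ) * Module.length R (K ⧸ (N ⊔ Ideal.ofList rs • (⊤ : Submodule R K))) := by
  induction rs generalizing N with
  | nil => rw [List.map_nil, List.length_nil, pow_zero, Nat.cast_one, one_mul]
  | cons r rs ih =>
    rw [List.map_cons, Ideal.ofList_cons_smul, Ideal.ofList_cons_smul, sup_left_comm N, sup_comm,
      ← sup_assoc N]
    refine (length_quotient_sup_pow_le _ r m).trans ?_
    rw [sup_right_comm]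
    refine (mul_le_mul_right (ih (N ⊔ r • ⊤)) _).trans (le_of_eq ?_)
    rw [List.length_cons, pow_succ']
    push_cast
    ring

lemma length_quotient_ofList_pow_le (K : Type*) [AddCommGroup K] [Module R K]
    (rs : List R) (m : ℕ) :
    Module.length R (K ⧸ (Ideal.ofList (rs.map (· ^ m)) • (⊤ : Submodule R K))) ≤
      (m ^ rs.length : ℕ) * Module.length R (K ⧸ (Ideal.ofList rs • (⊤ : Submodule R K))) := by
  have h := length_quotient_sup_ofList_pow_le (⊥ : Submodule R K) rs m
  rwa [bot_sup_eq, bot_sup_eq] at h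

lemma length_ne_top_of_maximalIdeal_le_radical [IsLocalRing R] [IsNoetherianRing R]
    (K : Type*) [AddCommGroup K] [Module R K] [Module.Finite R K]
    {I : Ideal R} (hI : maximalIdeal R ≤ I.radical) :
    Module.length R (K ⧸ (I • (⊤ : Submodule R K))) ≠ ⊤ := by
  by_cases htop : I = ⊤
  · have : Subsingleton (K ⧸ (I • (⊤ : Submodule R K))) := by
      rw [Submodule.Quotient.subsingleton_iff, htop, Submodule.top_smul]
    simp
  have hmin : maximalIdeal R ∈ I.minimalPrimes := by
    refine ⟨⟨inferInstance, le_maximalIdeal htop⟩, ?_⟩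
    rintro Q ⟨hQ, hQle⟩ -
    exact hI.trans (hQ.radical_le_iff.2 hQle)
  have := quotient_artinian_of_mem_minimalPrimes_of_isLocalRing I hmin
  have : Module.Finite (R ⧸ I) (K ⧸ (I • (⊤ : Submodule R K))) :=
    Module.Finite.of_restrictScalars_finite R _ _
  rw [Module.length_eq_of_surjective (R := R ⧸ I) (S := R) Ideal.Quotient.mk_surjective]
  exact Module.length_ne_top

lemma length_quotient_cons (K : Type*) [AddCommGroup K] [Module R K] (r : R) (rs : List R) :
    Module.length R (QuotSMulTop r K ⧸ (Ideal.ofList rs • (⊤ : Submodule R (QuotSMulTop r K)))) =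
      Module.length R (K ⧸ (Ideal.ofList (r :: rs) • (⊤ : Submodule R K))) :=
  (Submodule.quotOfListConsSMulTopEquivQuotSMulTopInner K r rs).symm.length_eq

lemma eq_of_le_of_sub_pow_le {m : ℕ} (hm : 0 < m) {a b k e L : ℕ∞} (hL : L ≠ ⊤)
    (h : a + b = k + e) (ha : a ≤ (m - 1 : ℕ) * b) (hb : b ≤ L) (he : m * L ≤ e) :
    k = 0 ∧ L ≤ b := by
  obtain ⟨n, rfl⟩ : ∃ n, m = n + 1 := ⟨m - 1, by omega⟩
  have hbt : b ≠ ⊤ := ne_top_of_le_ne_top hL hb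
  have hat : a ≠ ⊤ := ne_top_of_le_ne_top (WithTop.mul_ne_top (ENat.natCast_ne_top _) hbt) ha
  have hab : a + b ≠ ⊤ := WithTop.add_ne_top.2 ⟨hat, hbt⟩
  have hke : k + e ≠ ⊤ := h ▸ hab
  obtain ⟨hk, he'⟩ := WithTop.add_ne_top.1 hke
  lift a to ℕ using hat
  lift b to ℕ using hbt
  lift k to ℕ using hk
  lift e to ℕ using he'
  lift L to ℕ using hL
  simp only [Nat.add_sub_cancel] at ha
  norm_cast at *
  have h1 : n * b ≤ n * L := Nat.mul_le_mul_left n hb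
  have h2 : (n + 1) * L = n * L + L := by ring
  refine ⟨by omega, by omega⟩

/-- A sequence in the maximal ideal is weakly regular on a finite module as soon as the length
of the quotient by powers of it grows as fast as possible. -/
theorem isWeaklyRegular_of_length_pow_ge [IsLocalRing R] [IsNoetherianRing R]
    {K : Type*} [AddCommGroup K] [Module R K] [Module.Finite R K]
    {rs : List R} (hrs : ∀ r ∈ rs, r ∈ maximalIdeal R)
    (hfin : Module.length R (K ⧸ (Ideal.ofList rs • (⊤ : Submodule R K))) ≠ ⊤)
    (h : ∀ m : ℕ, 0 < m →
      (m ^ rs.length : ℕ) * Module.length R (K ⧸ (Ideal.ofList rs • (⊤ : Submodule R K))) ≤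
      Module.length R (K ⧸ (Ideal.ofList (rs.map (· ^ m)) • (⊤ : Submodule R K)))) :
    IsWeaklyRegular K rs := by
  induction rs generalizing K with
  | nil => exact IsWeaklyRegular.nil R K
  | cons r rs ih =>
    set L := Module.length R (K ⧸ (Ideal.ofList (r :: rs) • (⊤ : Submodule R K))) with hL
    have key : ∀ m : ℕ, 0 < m →
        Module.length R (LinearMap.ker
          (mulQuot (Ideal.ofList (rs.map (· ^ m)) • (⊤ : Submodule R K)) r (r ^ (m - 1)))) = 0 ∧
        (m ^ rs.length : ℕ) * L ≤ Module.length R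
          (K ⧸ (Ideal.ofList (rs.map (· ^ m)) • (⊤ : Submodule R K) ⊔ r • ⊤)) := by
      intro m hm
      refine eq_of_le_of_sub_pow_le hm (WithTop.mul_ne_top (ENat.natCast_ne_top _) hfin)
        (length_add_eq_length_ker_add _ r (r ^ (m - 1))) (length_quotient_sup_pow_le _ r (m - 1))
        ?_ ?_
      · rw [sup_comm, hL, Ideal.ofList_cons_smul]
        exact length_quotient_sup_ofList_pow_le _ rs m
      · have h1 := h m hm
        rw [List.map_cons, Ideal.ofList_cons_smul, sup_comm, List.length_cons, pow_succ'] at h1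
        rw [← pow_succ', Nat.sub_add_cancel hm]
        refine le_of_eq_of_le ?_ h1
        push_cast
        ring
    rw [isWeaklyRegular_cons_iff]
    constructor
    · rw [isSMulRegular_iff_right_eq_zero_of_smul]
      intro x hx
      have hmem : ∀ i : ℕ, x ∈ (maximalIdeal R ^ i • ⊤ : Submodule R K) := by
        intro i
        have h0 := (key (i + 1) (Nat.succ_pos i)).1
        rw [Module.length_eq_zero_iff, Submodule.subsingleton_iff_eq_bot] at h0
        have h1 : (Submodule.Quotient.mk x : K ⧸ (Ideal.ofList (rs.map (· ^ (i + 1))) •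
            (⊤ : Submodule R K) ⊔ r ^ (i + 1 - 1) • ⊤)) = 0 := by
          rw [← Submodule.mem_bot R, ← h0, LinearMap.mem_ker, mulQuot_mk, hx]
          exact (Submodule.Quotient.mk_eq_zero _).2 (zero_mem _)
        rw [Submodule.Quotient.mk_eq_zero] at h1
        refine (sup_le ?_ ?_ : _ ≤ (maximalIdeal R ^ i • ⊤ : Submodule R K)) h1
        · refine Submodule.smul_mono_left (Ideal.span_le.2 ?_)
          intro s hs
          obtain ⟨t, ht, rfl⟩ := List.mem_map.1 hs
          exact Ideal.pow_le_pow_right (Nat.le_succ i)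
            (Ideal.pow_mem_pow (hrs t (List.mem_cons_of_mem r ht)) _)
        · rw [Nat.add_sub_cancel, ← Submodule.ideal_span_singleton_smul]
          refine Submodule.smul_mono_left ((Ideal.span_singleton_le_iff_mem _).2 ?_)
          exact Ideal.pow_mem_pow (hrs r List.mem_cons_self) _
      have hbot := Ideal.iInf_pow_smul_eq_bot_of_isLocalRing (M := K) (maximalIdeal R)
        Ideal.IsPrime.ne_top'
      rw [← Submodule.mem_bot R, ← hbot]
      exact (Submodule.mem_iInf _).2 hmem
    · refine ih (fun s hs => hrs s (List.mem_cons_of_mem r hs)) ?_ ?_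
      · rwa [length_quotient_cons]
      · intro m hm
        rw [length_quotient_cons, length_quotient_cons, Ideal.ofList_cons_smul r (rs.map _),
          sup_comm]
        exact (key m hm).2

end Length

section CohenMacaulay

variable {R : Type*} [CommRing R]

lemma mem_ofList {a : R} {as : List R} (h : a ∈ as) : a ∈ Ideal.ofList as :=
  Ideal.subset_span h

variable [IsLocalRing R]

/-- `N` is zero or maximal Cohen-Macaulay over a local ring of dimension `d`: every system of
parameters is a regular sequence. -/
def ParametersRegular (d : ℕ) (N : Type*) [AddCommGroup N] [Module R N] : Prop :=
  ∀ bs : List R, bs.length = d → (∀ b ∈ bs, b ∈ maximalIdeal R) →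
    maximalIdeal R ≤ (Ideal.ofList bs).radical → IsWeaklyRegular N bs

lemma maximalIdeal_le_radical_of_forall {as bs : List R}
    (ha : maximalIdeal R ≤ (Ideal.ofList as).radical)
    (h : ∀ a ∈ as, a ∈ (Ideal.ofList bs).radical) :
    maximalIdeal R ≤ (Ideal.ofList bs).radical := by
  refine ha.trans ?_
  rw [← Ideal.radical_idem (Ideal.ofList bs)]
  exact Ideal.radical_mono (Ideal.span_le.2 h)

lemma length_quotient_ofList_append_pow_eq {d : ℕ} {K : Type*} [AddCommGroup K] [Module R K]
    (hK : ParametersRegular (R := R) d K) (ps rs : List R) (hl : (ps ++ rs).length = d)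
    (hm : ∀ b ∈ ps ++ rs, b ∈ maximalIdeal R)
    (hrad : maximalIdeal R ≤ (Ideal.ofList (ps ++ rs)).radical) {m : ℕ} (hm0 : 0 < m) :
    Module.length R (K ⧸ (Ideal.ofList (ps ++ rs.map (· ^ m)) • (⊤ : Submodule R K))) =
      (m ^ rs.length : ℕ) *
        Module.length R (K ⧸ (Ideal.ofList (ps ++ rs) • (⊤ : Submodule R K))) := by
  induction rs generalizing ps with
  | nil => rw [List.map_nil, List.length_nil, pow_zero, Nat.cast_one, one_mul]
  | cons r rs ih =>
    have hreg : IsWeaklyRegular K ((ps ++ rs.map (· ^ m)) ++ [r]) := by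
      refine hK _ (by simpa using hl) ?_ ?_
      · intro b hb
        simp only [List.mem_append, List.mem_map, List.mem_singleton] at hb
        rcases hb with (hb | ⟨t, ht, rfl⟩) | rfl
        · exact hm b (by simp [hb])
        · exact Ideal.pow_mem_of_mem _ (hm t (by simp [ht])) m hm0
        · exact hm b (by simp)
      · refine maximalIdeal_le_radical_of_forall hrad ?_
        intro a ha
        simp only [List.mem_append, List.mem_cons] at ha
        rcases ha with ha | rfl | ha
        · exact Ideal.le_radical (mem_ofList (by simp [ha]))
        · exact Ideal.le_radical (mem_ofList (by simp))
        · refine ⟨m, mem_ofList ?_⟩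
          simp only [List.mem_append, List.mem_map]
          exact Or.inl (Or.inr ⟨a, ha, rfl⟩)
    rw [isWeaklyRegular_append_iff, isWeaklyRegular_singleton_iff] at hreg
    have h1 := length_quotient_sup_pow_eq _ r hreg.2 m
    have e : ∀ s : R, ∀ l : List R, Ideal.ofList (ps ++ s :: l) • (⊤ : Submodule R K) =
        Ideal.ofList (ps ++ l) • (⊤ : Submodule R K) ⊔ s • ⊤ := by
      intro s l
      rw [Ideal.ofList_append, Ideal.ofList_cons, Ideal.ofList_append,
        ← Submodule.ideal_span_singleton_smul, ← Submodule.sup_smul]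
      congr 1
      ac_rfl
    have h2 := ih (ps ++ [r]) (by simpa using hl) (by simpa using hm) (by simpa using hrad)
    rw [← List.append_cons, ← List.append_cons] at h2
    rw [List.map_cons, e, h1, ← e, h2, List.length_cons, pow_succ']
    push_cast
    ring

lemma length_quotient_ofList_pow_eq {d : ℕ} {K : Type*} [AddCommGroup K] [Module R K]
    (hK : ParametersRegular (R := R) d K) {rs : List R} (hl : rs.length = d)
    (hm : ∀ b ∈ rs, b ∈ maximalIdeal R)
    (hrad : maximalIdeal R ≤ (Ideal.ofList rs).radical) {m : ℕ} (hm0 : 0 < m) :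
    Module.length R (K ⧸ (Ideal.ofList (rs.map (· ^ m)) • (⊤ : Submodule R K))) =
      (m ^ d : ℕ) * Module.length R (K ⧸ (Ideal.ofList rs • (⊤ : Submodule R K))) := by
  have h := length_quotient_ofList_append_pow_eq hK [] rs hl hm hrad hm0
  rwa [List.nil_append, List.nil_append, hl] at h

end CohenMacaulay

section Multiplicity

variable {R : Type*} [CommRing R]

lemma length_pi_quotient (s : ℕ) (J : Ideal R) :
    Module.length R ((Fin s → R) ⧸ (J • (⊤ : Submodule R (Fin s → R)))) =
      s * Module.length R (R ⧸ (J • (⊤ : Submodule R R))) := by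
  have e1 := ((TensorProduct.quotTensorEquivQuotSMul (Fin s → R) J).symm ≪≫ₗ
    TensorProduct.piScalarRight R R (R ⧸ J) (Fin s)).length_eq
  have e2 : J • (⊤ : Submodule R R) = J := by simp
  rw [e1, e2, Module.length_pi_of_fintype]
  simp

lemma length_quotient_le_of_smul_mem_range {P Q : Type*} [AddCommGroup P] [Module R P]
    [AddCommGroup Q] [Module R Q] (I : Ideal R) (f : P →ₗ[R] Q) (c : R)
    (hc : ∀ q, c • q ∈ LinearMap.range f) {s : ℕ} (g : (Fin s → R) →ₗ[R] Q)
    (hg : Function.Surjective g) :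
    Module.length R (Q ⧸ (I • (⊤ : Submodule R Q))) ≤
      Module.length R (P ⧸ (I • (⊤ : Submodule R P))) +
      s * Module.length R (R ⧸ ((Ideal.span {c} ⊔ I) • (⊤ : Submodule R R))) := by
  set h : (P ⧸ (I • (⊤ : Submodule R P))) →ₗ[R] Q ⧸ (I • (⊤ : Submodule R Q)) :=
    Submodule.mapQ _ _ f (Submodule.smul_top_le_comap_smul_top I f) with hh
  have h1 := Module.length_eq_add_of_exact (LinearMap.range h).subtype
    (LinearMap.range h).mkQ (Submodule.subtype_injective _) (Submodule.mkQ_surjective _) (by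
      rw [LinearMap.exact_iff, Submodule.ker_mkQ, Submodule.range_subtype])
  rw [h1]
  refine add_le_add (Module.length_le_of_surjective h.rangeRestrict
    h.surjective_rangeRestrict) ?_
  rw [← length_pi_quotient]
  set k : (Fin s → R) →ₗ[R] (Q ⧸ (I • (⊤ : Submodule R Q))) ⧸ LinearMap.range h :=
    (LinearMap.range h).mkQ ∘ₗ Submodule.mkQ _ ∘ₗ g with hk
  have hks : Function.Surjective k :=
    (Submodule.mkQ_surjective _).comp ((Submodule.mkQ_surjective _).comp hg)
  have hker : (Ideal.span {c} ⊔ I) • (⊤ : Submodule R (Fin s → R)) ≤ LinearMap.ker k := by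
    rw [Submodule.sup_smul]
    refine sup_le ?_ ?_
    · rw [Submodule.smul_le]
      intro r hr x _
      obtain ⟨a, rfl⟩ := Ideal.mem_span_singleton'.1 hr
      rw [mul_smul]
      refine Submodule.smul_mem _ a ?_
      obtain ⟨p, hp⟩ := hc (g x)
      rw [LinearMap.mem_ker, hk, LinearMap.comp_apply, LinearMap.comp_apply, map_smul, ← hp,
        Submodule.mkQ_apply _ (_ : Q ⧸ _), Submodule.Quotient.mk_eq_zero]
      exact ⟨Submodule.Quotient.mk p, rfl⟩
    · rw [Submodule.smul_le]
      intro r hr x _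
      rw [LinearMap.mem_ker, hk, LinearMap.comp_apply, LinearMap.comp_apply, map_smul]
      have : (I • (⊤ : Submodule R Q)).mkQ (r • g x) = 0 :=
        (Submodule.Quotient.mk_eq_zero _).2 (Submodule.smul_mem_smul hr trivial)
      rw [this, map_zero]
  refine Module.length_le_of_surjective (Submodule.liftQ _ k hker) ?_
  intro y
  obtain ⟨x, rfl⟩ := hks y
  exact ⟨Submodule.Quotient.mk x, rfl⟩

lemma ofList_pow_le (rs : List R) (m : ℕ) :
    Ideal.ofList rs ^ (rs.length * m + 1) ≤ Ideal.ofList (rs.map (· ^ m)) := by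
  induction rs with
  | nil => simp
  | cons r rs ih =>
    rw [List.map_cons, Ideal.ofList_cons, Ideal.ofList_cons, List.length_cons,
      show (rs.length + 1) * m + 1 = m + (rs.length * m + 1) by ring]
    refine Ideal.sup_pow_add_le_pow_sup_pow.trans (sup_le_sup (le_of_eq ?_) ih)
    rw [Ideal.span_singleton_pow]

lemma length_quotient_anti (K : Type*) [AddCommGroup K] [Module R K] {I J : Ideal R}
    (h : I ≤ J) : Module.length R (K ⧸ (J • (⊤ : Submodule R K))) ≤
      Module.length R (K ⧸ (I • (⊤ : Submodule R K))) :=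
  Module.length_le_of_surjective (Submodule.factor (Submodule.smul_mono_left h))
    (Submodule.factor_surjective _)

lemma le_of_forall_pow_mul_le {a b C : ℕ∞} {e : ℕ} (hC : C ≠ ⊤)
    (h : ∀ m : ℕ, 0 < m → (m ^ (e + 1) : ℕ) * a ≤ (m ^ (e + 1) : ℕ) * b + (m ^ e : ℕ) * C) :
    a ≤ b := by
  by_cases hb : b = ⊤
  · simp [hb]
  have ha : a ≠ ⊤ := by
    have h1 := h 1 one_pos
    simp only [one_pow, Nat.cast_one, one_mul] at h1
    exact ne_top_of_le_ne_top (WithTop.add_ne_top.2 ⟨hb, hC⟩) h1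
  lift a to ℕ using ha
  lift b to ℕ using hb
  lift C to ℕ using hC
  norm_cast at h ⊢
  by_contra hlt
  have h1 := h (C + 1) (Nat.succ_pos C)
  have h2 : (C + 1) ^ e * ((C + 1) * a) ≤ (C + 1) ^ e * ((C + 1) * b + C) := by
    calc _ = (C + 1) ^ (e + 1) * a := by ring
      _ ≤ _ := h1
      _ = _ := by ring
  have h3 := Nat.le_of_mul_le_mul_left h2 (by positivity)
  have h4 : (C + 1) * (b + 1) ≤ (C + 1) * a := Nat.mul_le_mul_left _ (by omega)
  have h5 : (C + 1) * (b + 1) = (C + 1) * b + C + 1 := by ring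
  omega

/-- A finite module of rank `r` is isomorphic to `R ^ r` up to a nonzerodivisor. -/
lemma exists_rank_maps [IsNoetherianRing R] {M : Type*} [AddCommGroup M] [Module R M]
    [Module.Finite R M] {r : ℕ}
    (h : LocalizedModule (nonZeroDivisors R) M ≃ₗ[Localization (nonZeroDivisors R)]
      (Fin r → Localization (nonZeroDivisors R))) :
    ∃ c ∈ nonZeroDivisors R, ∃ (u : (Fin r → R) →ₗ[R] M) (v : M →ₗ[R] (Fin r → R)),
      (∀ a, v (u a) = c • a) ∧ ∀ x, u (v x) = c • x := by
  let S := nonZeroDivisors R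
  let Q := Localization S
  let f : M →ₗ[R] LocalizedModule S M := LocalizedModule.mkLinearMap S M
  let g : (Fin r → R) →ₗ[R] (Fin r → Q) := .pi fun i ↦ Algebra.linearMap R Q ∘ₗ .proj i
  have : IsLocalizedModule S g := inferInstance
  let e : LocalizedModule S M ≃ₗ[R] (Fin r → Q) := h.restrictScalars R
  have : Module.FinitePresentation R M := Module.finitePresentation_of_finite R M
  obtain ⟨v, s, hv⟩ := Module.FinitePresentation.exists_lift_of_isLocalizedModule S g
    (e.toLinearMap ∘ₗ f)
  obtain ⟨u, t, hu⟩ := Module.FinitePresentation.exists_lift_of_isLocalizedModule S f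
    (e.symm.toLinearMap ∘ₗ g)
  have hv' : ∀ x, g (v x) = (s : R) • e (f x) := fun x => LinearMap.congr_fun hv x
  have hu' : ∀ x, f (u x) = (t : R) • e.symm (g x) := fun x => LinearMap.congr_fun hu x
  have hgu : g ∘ₗ (v ∘ₗ u) = g ∘ₗ (((s : R) * t) • LinearMap.id) := by
    refine LinearMap.ext fun x => ?_
    simp only [LinearMap.comp_apply, LinearMap.smul_apply, LinearMap.id_apply]
    rw [hv', hu', map_smul, e.apply_symm_apply, smul_smul, map_smul]
  have hfv : f ∘ₗ (u ∘ₗ v) = f ∘ₗ (((s : R) * t) • LinearMap.id) := by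
    refine LinearMap.ext fun x => ?_
    simp only [LinearMap.comp_apply, LinearMap.smul_apply, LinearMap.id_apply]
    rw [hu', hv', map_smul, e.symm_apply_apply, smul_smul, map_smul, mul_comm]
  obtain ⟨w₁, h₁⟩ := Module.Finite.exists_smul_of_comp_eq_of_isLocalizedModule S g _ _ hgu
  obtain ⟨w₂, h₂⟩ := Module.Finite.exists_smul_of_comp_eq_of_isLocalizedModule S f _ _ hfv
  refine ⟨((w₁ * w₂ * (s * t) : S) : R), (w₁ * w₂ * (s * t)).2, u, (w₁ * w₂) • v, ?_, ?_⟩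
  · intro a
    have h3 : (w₁ : R) • v (u a) = (w₁ : R) • ((s : R) * t) • a := LinearMap.congr_fun h₁ a
    change ((w₁ * w₂ : S) : R) • v (u a) = _
    push_cast
    rw [mul_comm (w₁ : R), mul_smul, h3, smul_smul, smul_smul, mul_assoc]
  · intro x
    have h3 : (w₂ : R) • u (v x) = (w₂ : R) • ((s : R) * t) • x := LinearMap.congr_fun h₂ x
    change u (((w₁ * w₂ : S) : R) • v x) = _
    push_cast
    rw [map_smul, mul_smul, h3, smul_smul, smul_smul, mul_assoc]

variable [IsLocalRing R] [IsNoetherianRing R]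

lemma exists_parameters_of_mem_nonZeroDivisors {e : ℕ} (hdim : ringKrullDim R = (e + 1 : ℕ))
    {c : R} (hc : c ∈ nonZeroDivisors R) (hcm : c ∈ maximalIdeal R) :
    ∃ zs : List R, zs.length = e ∧ (∀ z ∈ zs, z ∈ maximalIdeal R) ∧
      maximalIdeal R ≤ (Ideal.span {c} ⊔ Ideal.ofList zs).radical := by
  have hne : Ideal.span {c} ≠ ⊤ := fun h =>
    (Ideal.IsPrime.ne_top' : maximalIdeal R ≠ ⊤)
      (top_le_iff.1 (h ▸ (Ideal.span_singleton_le_iff_mem _).2 hcm))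
  have : Nontrivial (R ⧸ Ideal.span {c}) := Ideal.Quotient.nontrivial_iff.2 hne
  have hs : Function.Surjective (Ideal.Quotient.mk (Ideal.span {c})) := Ideal.Quotient.mk_surjective
  have : IsLocalRing (R ⧸ Ideal.span {c}) := IsLocalRing.of_surjective' _ hs
  have hloc : IsLocalHom (Ideal.Quotient.mk (Ideal.span {c})) := hs.isLocalHom _
  have h1 := ringKrullDim_quotient_span_singleton_succ_eq_ringKrullDim_of_mem_nonZeroDivisors hc hcm
  obtain ⟨s, hsmin, hcard⟩ := Ideal.exists_finset_card_eq_height_of_isNoetherianRing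
    (maximalIdeal (R ⧸ Ideal.span {c}))
  have h2 : s.card = e := by
    have h3 := maximalIdeal_height_eq_ringKrullDim (R := R ⧸ Ideal.span {c})
    rw [← hcard] at h3
    rw [hdim, ← h3] at h1
    norm_cast at h1
    have h4 : s.card + 1 = e + 1 := by exact_mod_cast h1
    omega
  have hmem : ∀ z : R, z ∈ maximalIdeal R ↔
      Ideal.Quotient.mk (Ideal.span {c}) z ∈ maximalIdeal (R ⧸ Ideal.span {c}) := by
    intro z
    rw [mem_maximalIdeal, mem_maximalIdeal, map_mem_nonunits_iff]
  refine ⟨s.toList.map (Function.surjInv hs), by simp [h2], ?_, ?_⟩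
  · intro z hz
    obtain ⟨y, hy, rfl⟩ := List.mem_map.1 hz
    rw [hmem, Function.surjInv_eq hs]
    exact hsmin.1.2 (Ideal.subset_span (by simpa using hy))
  · intro z hz
    rw [hmem] at hz
    have hrad : maximalIdeal (R ⧸ Ideal.span {c}) ≤ (Ideal.span (s : Set (R ⧸ Ideal.span {c}))).radical := by
      rw [Ideal.radical_eq_sInf]
      refine le_sInf ?_
      rintro P ⟨hP, hprime⟩
      exact hsmin.2 ⟨hprime, hP⟩ (le_maximalIdeal Ideal.IsPrime.ne_top')
    obtain ⟨k, hk⟩ := hrad hz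
    refine ⟨k, ?_⟩
    have hmap : Ideal.span (s : Set (R ⧸ Ideal.span {c})) =
        (Ideal.ofList (s.toList.map (Function.surjInv hs))).map (Ideal.Quotient.mk _) := by
      rw [Ideal.map_ofList, List.map_map]
      have : (⇑(Ideal.Quotient.mk (Ideal.span {c})) ∘ Function.surjInv hs) = id :=
        funext (Function.surjInv_eq hs)
      rw [this, List.map_id, Ideal.ofList]
      simp
    rw [hmap, ← map_pow, ← Ideal.mem_comap, Ideal.comap_map_of_surjective' _ hs, Ideal.mk_ker,
      sup_comm] at hk
    exact hk

/-- Modulo a nonzerodivisor, the length of the quotient by powers of a system of parameters grows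
with order less than the dimension. -/
lemma exists_length_quotient_le {e : ℕ} (hdim : ringKrullDim R = (e + 1 : ℕ))
    {c : R} (hc : c ∈ nonZeroDivisors R) {rs : List R}
    (hrad : maximalIdeal R ≤ (Ideal.ofList rs).radical) :
    ∃ C : ℕ∞, C ≠ ⊤ ∧ ∀ m : ℕ, 0 < m →
      Module.length R (R ⧸ ((Ideal.span {c} ⊔ Ideal.ofList (rs.map (· ^ m))) •
        (⊤ : Submodule R R))) ≤ (m ^ e : ℕ) * C := by
  by_cases hcm : c ∈ maximalIdeal R
  · obtain ⟨zs, hl, hzm, hz⟩ := exists_parameters_of_mem_nonZeroDivisors hdim hc hcm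
    obtain ⟨N, hN⟩ := Ideal.exists_pow_le_of_le_radical_of_fg hrad
      (IsNoetherian.noetherian (maximalIdeal R))
    refine ⟨((N * (rs.length + 1)) ^ e : ℕ) * Module.length R
      (R ⧸ ((Ideal.span {c} ⊔ Ideal.ofList zs) • (⊤ : Submodule R R))),
      WithTop.mul_ne_top (ENat.natCast_ne_top _) (length_ne_top_of_maximalIdeal_le_radical R hz), ?_⟩
    intro m hm
    have hle : Ideal.ofList (zs.map (· ^ (N * (rs.length + 1) * m))) ≤
        Ideal.ofList (rs.map (· ^ m)) := by
      refine Ideal.span_le.2 ?_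
      intro z hz
      obtain ⟨t, ht, rfl⟩ := List.mem_map.1 hz
      refine ofList_pow_le rs m (Ideal.pow_right_mono hN _ ?_)
      rw [← pow_mul]
      refine Ideal.pow_le_pow_right ?_ (Ideal.pow_mem_pow (hzm t ht) _)
      rw [mul_assoc]
      refine Nat.mul_le_mul_left N ?_
      rw [add_mul, one_mul]
      omega
    refine (length_quotient_anti R (sup_le_sup_left hle _)).trans ?_
    rw [Submodule.sup_smul, Submodule.sup_smul]
    refine (length_quotient_sup_ofList_pow_le _ zs _).trans (le_of_eq ?_)
    rw [hl, mul_pow]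
    push_cast
    ring
  · refine ⟨0, ENat.zero_ne_top, fun m _ => ?_⟩
    have hu : IsUnit c := by simpa using hcm
    have : Subsingleton (R ⧸ ((Ideal.span {c} ⊔ Ideal.ofList (rs.map (· ^ m))) •
        (⊤ : Submodule R R))) := by
      rw [Submodule.Quotient.subsingleton_iff, Ideal.span_singleton_eq_top.2 hu, top_sup_eq,
        Submodule.top_smul]
    simp

variable {K : Type*} [AddCommGroup K] [Module R K]

/-- Over a Cohen-Macaulay ring, the length of `K / xK` is at least `rank K` times that of `R / x`. -/
theorem rank_mul_length_le {e : ℕ} (hdim : ringKrullDim R = (e + 1 : ℕ))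
    (hR : ParametersRegular (R := R) (e + 1) R) {rs : List R} (hl : rs.length = e + 1)
    (hm : ∀ b ∈ rs, b ∈ maximalIdeal R)
    (hrad : maximalIdeal R ≤ (Ideal.ofList rs).radical)
    {r : ℕ} {c : R} (hc : c ∈ nonZeroDivisors R) (u : (Fin r → R) →ₗ[R] K)
    (v : K →ₗ[R] (Fin r → R)) (hvu : ∀ a, v (u a) = c • a) :
    r * Module.length R (R ⧸ (Ideal.ofList rs • (⊤ : Submodule R R))) ≤
      Module.length R (K ⧸ (Ideal.ofList rs • (⊤ : Submodule R K))) := by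
  obtain ⟨C, hC, hbound⟩ := exists_length_quotient_le hdim hc hrad
  refine le_of_forall_pow_mul_le (e := e) (C := r * C)
    (WithTop.mul_ne_top (ENat.natCast_ne_top _) hC) fun m hm0 => ?_
  have h1 := length_quotient_le_of_smul_mem_range (Ideal.ofList (rs.map (· ^ m))) v c
    (fun a => ⟨u a, hvu a⟩) (LinearMap.id : (Fin r → R) →ₗ[R] _) Function.surjective_id
  rw [length_pi_quotient, length_quotient_ofList_pow_eq hR hl hm hrad hm0] at h1
  have h2 := length_quotient_ofList_pow_le K rs m
  rw [hl] at h2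
  calc _ = _ := by ring
    _ ≤ _ := h1
    _ ≤ _ := add_le_add h2 (mul_le_mul_right (hbound m hm0) _)
    _ = _ := by ring

theorem length_eq_rank_mul {e : ℕ} (hdim : ringKrullDim R = (e + 1 : ℕ))
    (hR : ParametersRegular (R := R) (e + 1) R) [Module.Finite R K]
    (hK : ParametersRegular (R := R) (e + 1) K) {rs : List R} (hl : rs.length = e + 1)
    (hm : ∀ b ∈ rs, b ∈ maximalIdeal R)
    (hrad : maximalIdeal R ≤ (Ideal.ofList rs).radical)
    {r : ℕ} {c : R} (hc : c ∈ nonZeroDivisors R) (u : (Fin r → R) →ₗ[R] K)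
    (v : K →ₗ[R] (Fin r → R)) (hvu : ∀ a, v (u a) = c • a) (huv : ∀ x, u (v x) = c • x) :
    Module.length R (K ⧸ (Ideal.ofList rs • (⊤ : Submodule R K))) =
      r * Module.length R (R ⧸ (Ideal.ofList rs • (⊤ : Submodule R R))) := by
  refine le_antisymm ?_ (rank_mul_length_le hdim hR hl hm hrad hc u v hvu)
  obtain ⟨C, hC, hbound⟩ := exists_length_quotient_le hdim hc hrad
  obtain ⟨s, g, hg⟩ := Module.Finite.exists_fin' R K
  refine le_of_forall_pow_mul_le (e := e) (C := s * C)
    (WithTop.mul_ne_top (ENat.natCast_ne_top _) hC) fun m hm0 => ?_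
  have h1 := length_quotient_le_of_smul_mem_range (Ideal.ofList (rs.map (· ^ m))) u c
    (fun a => ⟨v a, huv a⟩) g hg
  rw [length_pi_quotient, length_quotient_ofList_pow_eq hR hl hm hrad hm0,
    length_quotient_ofList_pow_eq hK hl hm hrad hm0] at h1
  calc _ ≤ _ := h1
    _ ≤ _ := add_le_add_right (mul_le_mul_right (hbound m hm0) _) _
    _ = _ := by ring

/-- If `K / xK` has the least possible length, then `x` is a regular sequence on `K`. -/
theorem isWeaklyRegular_of_length_eq_rank_mul {e : ℕ} (hdim : ringKrullDim R = (e + 1 : ℕ))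
    (hR : ParametersRegular (R := R) (e + 1) R) [Module.Finite R K]
    {rs : List R} (hl : rs.length = e + 1)
    (hm : ∀ b ∈ rs, b ∈ maximalIdeal R)
    (hrad : maximalIdeal R ≤ (Ideal.ofList rs).radical)
    {r : ℕ} {c : R} (hc : c ∈ nonZeroDivisors R) (u : (Fin r → R) →ₗ[R] K)
    (v : K →ₗ[R] (Fin r → R)) (hvu : ∀ a, v (u a) = c • a)
    (heq : Module.length R (K ⧸ (Ideal.ofList rs • (⊤ : Submodule R K))) =
      r * Module.length R (R ⧸ (Ideal.ofList rs • (⊤ : Submodule R R)))) :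
    IsWeaklyRegular K rs := by
  refine isWeaklyRegular_of_length_pow_ge hm (length_ne_top_of_maximalIdeal_le_radical K hrad)
    fun m hm0 => ?_
  have h1 := rank_mul_length_le hdim hR (rs := rs.map (· ^ m)) (by simpa using hl)
    (by
      intro b hb
      obtain ⟨t, ht, rfl⟩ := List.mem_map.1 hb
      exact Ideal.pow_mem_of_mem _ (hm t ht) m hm0)
    (maximalIdeal_le_radical_of_forall hrad fun a ha =>
      ⟨m, mem_ofList (List.mem_map.2 ⟨a, ha, rfl⟩)⟩) hc u v hvu
  rw [length_quotient_ofList_pow_eq hR hl hm hrad hm0] at h1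
  refine le_of_eq_of_le ?_ h1
  rw [heq, hl]
  ring

end Multiplicity

open scoped Pointwise TensorProduct

section MinimalCover

variable {R : Type*} [CommRing R] [IsLocalRing R]

/-- A finite module over a local ring has a free cover whose kernel has coordinates in the
maximal ideal. -/
lemma exists_minimal_cover (M : Type*) [AddCommGroup M] [Module R M] [Module.Finite R M] :
    ∃ (n : ℕ) (π : (Fin n → R) →ₗ[R] M), Function.Surjective π ∧
      ∀ a, π a = 0 → ∀ i, a i ∈ maximalIdeal R := by
  let w := Module.finBasis (ResidueField R) (ResidueField R ⊗[R] M)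
  obtain ⟨v, hv⟩ := (TensorProduct.mk_surjective R M (ResidueField R)
    Ideal.Quotient.mk_surjective).comp_left w
  have hv' : ∀ i, (1 : ResidueField R) ⊗ₜ[R] v i = w i := fun i => congr_fun hv i
  refine ⟨_, Fintype.linearCombination R v, ?_, ?_⟩
  · rw [← LinearMap.range_eq_top, Fintype.range_linearCombination]
    exact span_eq_top_of_tmul_eq_basis v w hv'
  · intro a ha i
    have h1 : ∑ j, residue R (a j) • w j = 0 := by
      have h2 := congr_arg (fun x => (1 : ResidueField R) ⊗ₜ[R] x) ha
      simp only [Fintype.linearCombination_apply, TensorProduct.tmul_sum, TensorProduct.tmul_zero,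
        TensorProduct.tmul_smul, hv'] at h2
      exact h2
    have h3 := Fintype.linearIndependent_iff.1 w.linearIndependent _ h1 i
    exact (residue_eq_zero_iff _).1 h3

end MinimalCover

section BaseChange

variable {R : Type*} [CommRing R] (A : Type*) [CommRing A] [Algebra R A]

lemma ker_baseChange_mkQ (I : Ideal R) (M : Type*) [AddCommGroup M] [Module R M] :
    LinearMap.ker ((I • (⊤ : Submodule R M)).mkQ.baseChange A) =
      I.map (algebraMap R A) • (⊤ : Submodule A (A ⊗[R] M)) := by
  apply le_antisymm
  · intro t ht
    have hex := lTensor_exact A (LinearMap.exact_subtype_mkQ (I • (⊤ : Submodule R M)))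
      (Submodule.mkQ_surjective _)
    obtain ⟨s, rfl⟩ := (hex t).1 ht
    induction s using TensorProduct.induction_on with
    | zero => rw [map_zero]; exact zero_mem _
    | add x y hx hy =>
      rw [map_add]
      exact add_mem (hx (LinearMap.mem_ker.2 ((hex _).2 ⟨x, rfl⟩)))
        (hy (LinearMap.mem_ker.2 ((hex _).2 ⟨y, rfl⟩)))
    | tmul a z =>
      obtain ⟨z, hz⟩ := z
      change a ⊗ₜ[R] z ∈ _
      clear ht
      induction hz using Submodule.smul_induction_on' with
      | smul i hi m _ =>
        rw [TensorProduct.tmul_smul, ← algebraMap_smul A _ (a ⊗ₜ[R] _)]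
        exact Submodule.smul_mem_smul (Ideal.mem_map_of_mem _ hi) Submodule.mem_top
      | add x _ y _ hx hy =>
        rw [TensorProduct.tmul_add]
        exact add_mem hx hy
  · rw [Submodule.smul_le]
    intro b hb t _
    induction hb using Submodule.span_induction with
    | mem b hb =>
      obtain ⟨i, hi, rfl⟩ := hb
      rw [LinearMap.mem_ker, map_smul]
      induction t using TensorProduct.induction_on with
      | zero => simp
      | add x y hx hy => rw [map_add, smul_add, hx trivial, hy trivial, add_zero]
      | tmul a m =>
        rw [LinearMap.baseChange_tmul, algebraMap_smul, ← TensorProduct.tmul_smul, ← map_smul,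
          Submodule.mkQ_apply, (Submodule.Quotient.mk_eq_zero _).2 (Submodule.smul_mem_smul hi Submodule.mem_top),
          TensorProduct.tmul_zero]
    | zero => rw [zero_smul]; exact zero_mem _
    | add x y _ _ hx hy => rw [add_smul]; exact add_mem hx hy
    | smul a x _ hx => rw [smul_assoc]; exact Submodule.smul_mem _ a hx

/-- `A ⊗ (M / IM) ≃ (A ⊗ M) / I(A ⊗ M)`. -/
noncomputable def baseChangeQuotientEquiv (I : Ideal R) (M : Type*) [AddCommGroup M] [Module R M] :
    ((A ⊗[R] M) ⧸ (I.map (algebraMap R A) • (⊤ : Submodule A (A ⊗[R] M)))) ≃ₗ[A]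
      A ⊗[R] (M ⧸ (I • (⊤ : Submodule R M))) :=
  Submodule.quotEquivOfEq _ _ (ker_baseChange_mkQ A I M).symm ≪≫ₗ
    LinearMap.quotKerEquivOfSurjective _
      (LinearMap.lTensor_surjective A (Submodule.mkQ_surjective _))

/-- If a linear map stays injective after reduction modulo `I` and base change, then it stays
injective after base change and reduction modulo `I`. -/
lemma mem_smul_top_of_baseChange_mem {T F : Type*} [AddCommGroup T] [Module R T] [AddCommGroup F]
    [Module R F] (I : Ideal R) (f : T →ₗ[R] F)
    (hf : Function.Injective ((Submodule.mapQ _ _ f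
      (Submodule.smul_top_le_comap_smul_top I f)).baseChange A))
    {t : A ⊗[R] T} (ht : f.baseChange A t ∈
      I.map (algebraMap R A) • (⊤ : Submodule A (A ⊗[R] F))) :
    t ∈ I.map (algebraMap R A) • (⊤ : Submodule A (A ⊗[R] T)) := by
  rw [← ker_baseChange_mkQ, LinearMap.mem_ker] at ht ⊢
  apply hf
  rw [map_zero, ← LinearMap.comp_apply, ← LinearMap.baseChange_comp, Submodule.mapQ_mkQ,
    LinearMap.baseChange_comp, LinearMap.comp_apply, ht]

variable {A} in
lemma baseChange_apply_mem {n : ℕ} {I : Ideal R} {T : Type*} [AddCommGroup T] [Module R T]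
    (f : T →ₗ[R] (Fin n → R)) (hf : ∀ t i, f t i ∈ I) (t : A ⊗[R] T) :
    f.baseChange A t ∈ I.map (algebraMap R A) • (⊤ : Submodule A (A ⊗[R] (Fin n → R))) := by
  induction t using TensorProduct.induction_on with
  | zero => rw [map_zero]; exact zero_mem _
  | add x y hx hy => rw [map_add]; exact add_mem hx hy
  | tmul a t =>
    rw [LinearMap.baseChange_tmul, pi_eq_sum_univ' (f t), TensorProduct.tmul_sum]
    refine sum_mem fun i _ => ?_
    rw [TensorProduct.tmul_smul, ← algebraMap_smul A _ (a ⊗ₜ[R] _)]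
    exact Submodule.smul_mem_smul (Ideal.mem_map_of_mem _ (hf t i)) Submodule.mem_top

variable {A}
variable [IsLocalRing R] [IsLocalRing A] [IsLocalHom (algebraMap R A)]

lemma map_maximalIdeal_le : (maximalIdeal R).map (algebraMap R A) ≤ maximalIdeal A :=
  ((local_hom_TFAE (algebraMap R A)).out 0 2).1 ‹_›

lemma subsingleton_of_subsingleton_baseChange {N : Type*} [AddCommGroup N] [Module R N]
    [Module.Finite R N] (h : Subsingleton (A ⊗[R] N)) : Subsingleton N := by
  obtain ⟨n, π, hπ, hmin⟩ := exists_minimal_cover (R := R) N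
  have hle : (⊤ : Submodule A (A ⊗[R] (Fin n → R))) ≤
      (maximalIdeal R).map (algebraMap R A) • ⊤ := by
    intro x _
    have hex := lTensor_exact A (LinearMap.exact_subtype_ker_map π) hπ
    obtain ⟨t, rfl⟩ := (hex x).1 (Subsingleton.elim _ _)
    exact baseChange_apply_mem (LinearMap.ker π).subtype (fun t i => hmin t t.2 i) t
  have hs := subsingleton_of_le_smul_top map_maximalIdeal_le hle
  have hs' : Subsingleton (Fin n → A) :=
    (TensorProduct.piScalarRight R A A (Fin n)).symm.toEquiv.subsingleton
  have hn : IsEmpty (Fin n) := by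
    by_contra hne
    rw [not_isEmpty_iff] at hne
    exact not_subsingleton (Fin n → A) hs'
  exact hπ.subsingleton

end BaseChange

section Freeness

variable {R : Type*} [CommRing R] [IsLocalRing R]

lemma ParametersRegular.of_flat {d : ℕ} (hR : ParametersRegular (R := R) d R)
    (F : Type*) [AddCommGroup F] [Module R F] [Module.Flat R F] :
    ParametersRegular (R := R) d F := by
  intro bs hl hm hrad
  exact ((TensorProduct.lid R F).isWeaklyRegular_congr bs).1
    ((hR bs hl hm hrad).isWeaklyRegular_rTensor (M₂ := F))

lemma ParametersRegular.of_isWeaklyRegular [IsNoetherianRing R] {d : ℕ} (hdim : ringKrullDim R = d)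
    {N : Type*} [AddCommGroup N] [Module R N] [Module.Finite R N] {as : List R}
    (hal : as.length = d) (ham : ∀ a ∈ as, a ∈ maximalIdeal R)
    (h : IsWeaklyRegular N as) : ParametersRegular (R := R) d N :=
  fun _ hbl hbm hb => isWeaklyRegular_of_depth_eq hdim hal hbl ham hbm hb h

variable {A : Type*} [CommRing A] [IsLocalRing A] [IsNoetherianRing A] [Algebra R A]
  {M : Type*} [AddCommGroup M] [Module R M] {n : ℕ} {π : (Fin n → R) →ₗ[R] M}

/-- If the base change of a minimal cover stays exact modulo a system of parameters and the
maximal ideal expands into a parameter ideal, then the cover is injective. -/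
theorem injective_of_injective_baseChange_mod [IsNoetherianRing R] [IsLocalHom (algebraMap R A)]
    {d : ℕ} (hdim : ringKrullDim A = d)
    (hA : ParametersRegular (R := A) d A) [Module.Finite R M]
    (hπ : Function.Surjective π) (hmin : ∀ a, π a = 0 → ∀ i, a i ∈ maximalIdeal R)
    {xs : List R} (hxl : xs.length = d)
    (hxm : ∀ x ∈ xs.map (algebraMap R A), x ∈ maximalIdeal A)
    (hxr : maximalIdeal A ≤ (Ideal.ofList (xs.map (algebraMap R A))).radical)
    {ys : List A} (hyl : ys.length = d) (hym : ∀ y ∈ ys, y ∈ maximalIdeal A)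
    (hyr : maximalIdeal A ≤ (Ideal.ofList ys).radical)
    (hy : (maximalIdeal R).map (algebraMap R A) ≤ Ideal.ofList ys)
    (hinj : Function.Injective ((Submodule.mapQ _ _ (LinearMap.ker π).subtype
      (Submodule.smul_top_le_comap_smul_top (Ideal.ofList xs) _)).baseChange A)) :
    Function.Injective π := by
  have hex : Function.Exact ((LinearMap.ker π).subtype.baseChange A) (π.baseChange A) :=
    lTensor_exact A (LinearMap.exact_subtype_ker_map π) hπ
  have hsurj : Function.Surjective (π.baseChange A) := LinearMap.lTensor_surjective A hπ
  have hxl' : (xs.map (algebraMap R A)).length = d := by simpa using hxl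
  obtain ⟨hf, hreg⟩ := injective_and_isWeaklyRegular_of_injective_mod hex hsurj hxm
    (hA.of_flat _ _ hxl' hxm hxr) (fun t ht => by
      rw [← Ideal.map_ofList] at ht ⊢
      exact mem_smul_top_of_baseChange_mem A _ _ hinj ht)
  have hD := ParametersRegular.of_isWeaklyRegular hdim hxl' hxm hreg ys hyl hym hyr
  have hT : Subsingleton (A ⊗[R] LinearMap.ker π) := by
    refine subsingleton_of_le_smul_top (Ideal.span_le.2 hym) fun t _ => ?_
    refine mem_smul_top_of_map_mem hf hex hsurj hD ?_
    exact Submodule.smul_mono_left hy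
      (baseChange_apply_mem (LinearMap.ker π).subtype (fun t i => hmin t t.2 i) t)
  rw [← LinearMap.ker_eq_bot, ← Submodule.subsingleton_iff_eq_bot]
  exact subsingleton_of_subsingleton_baseChange hT

/-- If a system of parameters is regular on the base change of `M` and the maximal ideal expands
into a parameter ideal, then the base change of a minimal cover of `M` is injective. -/
theorem baseChange_injective_of_isWeaklyRegular {d : ℕ} (hdim : ringKrullDim A = d)
    [Module.Finite R M]
    (hπ : Function.Surjective π) (hmin : ∀ a, π a = 0 → ∀ i, a i ∈ maximalIdeal R)
    {xs : List A} (hxl : xs.length = d) (hxm : ∀ x ∈ xs, x ∈ maximalIdeal A)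
    (hx : IsWeaklyRegular (A ⊗[R] M) xs)
    {ys : List A} (hyl : ys.length = d) (hym : ∀ y ∈ ys, y ∈ maximalIdeal A)
    (hyr : maximalIdeal A ≤ (Ideal.ofList ys).radical)
    (hy : (maximalIdeal R).map (algebraMap R A) ≤ Ideal.ofList ys) :
    Function.Injective (π.baseChange A) := by
  have hex : Function.Exact ((LinearMap.ker π).subtype.baseChange A) (π.baseChange A) :=
    lTensor_exact A (LinearMap.exact_subtype_ker_map π) hπ
  have hsurj : Function.Surjective (π.baseChange A) := LinearMap.lTensor_surjective A hπ
  have hD := ParametersRegular.of_isWeaklyRegular hdim hxl hxm hx ys hyl hym hyr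
  have hT : Subsingleton (LinearMap.ker (π.baseChange A)) := by
    refine subsingleton_of_le_smul_top (Ideal.span_le.2 hym) fun t _ => ?_
    refine mem_smul_top_of_map_mem (Submodule.subtype_injective _)
      (LinearMap.exact_subtype_ker_map _) hsurj hD ?_
    obtain ⟨s, hs⟩ := (hex t.1).1 t.2
    rw [Submodule.subtype_apply, ← hs]
    exact Submodule.smul_mono_left hy
      (baseChange_apply_mem (LinearMap.ker π).subtype (fun t i => hmin t t.2 i) s)
  rwa [← LinearMap.ker_eq_bot, ← Submodule.subsingleton_iff_eq_bot]

/-- A module over a Cohen-Macaulay local ring whose minimal syzygy is free is itself free if some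
system of parameters is regular on it. -/
theorem injective_of_free_ker [IsNoetherianRing R]
    (hπ : Function.Surjective π) (hmin : ∀ a, π a = 0 → ∀ i, a i ∈ maximalIdeal R)
    {xs : List R} (hxm : ∀ x ∈ xs, x ∈ maximalIdeal R)
    (hxr : maximalIdeal R ≤ (Ideal.ofList xs).radical) (hx : IsWeaklyRegular M xs)
    [Module.Free R (LinearMap.ker π)] : Function.Injective π := by
  classical
  obtain ⟨N, hN⟩ := Ideal.exists_pow_le_of_le_radical_of_fg hxr
    (IsNoetherian.noetherian (maximalIdeal R))
  have hI : Ideal.ofList xs ≤ maximalIdeal R := Ideal.span_le.2 hxm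
  obtain ⟨s, hs, hsm⟩ : ∃ s, s ∉ Ideal.ofList xs ∧
      ∀ t ∈ maximalIdeal R, s * t ∈ Ideal.ofList xs := by
    have hex : ∃ N, maximalIdeal R ^ N ≤ Ideal.ofList xs := ⟨N, hN⟩
    have hpos : Nat.find hex ≠ 0 := by
      intro h0
      have h1 := Nat.find_spec hex
      rw [h0, pow_zero, Ideal.one_eq_top] at h1
      exact (Ideal.IsPrime.ne_top' : maximalIdeal R ≠ ⊤) (top_le_iff.1 (h1.trans hI))
    have h2 := Nat.find_min hex (m := Nat.find hex - 1) (by omega)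
    obtain ⟨s, hs, hsn⟩ := SetLike.not_le_iff_exists.1 h2
    refine ⟨s, hsn, fun t ht => Nat.find_spec hex ?_⟩
    rw [show Nat.find hex = (Nat.find hex - 1) + 1 by omega, pow_succ]
    exact Ideal.mul_mem_mul hs ht
  rw [← LinearMap.ker_eq_bot, ← Submodule.subsingleton_iff_eq_bot]
  let b := Module.Free.chooseBasis R (LinearMap.ker π)
  rcases isEmpty_or_nonempty (Module.Free.ChooseBasisIndex R (LinearMap.ker π)) with he | ⟨⟨i⟩⟩
  · exact b.repr.toEquiv.subsingleton
  exfalso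
  apply hs
  have h1 : s • b i ∈ Ideal.ofList xs • (⊤ : Submodule R (LinearMap.ker π)) := by
    refine mem_smul_top_of_map_mem (Submodule.subtype_injective _)
      (LinearMap.exact_subtype_ker_map π) hπ hx ?_
    rw [Submodule.subtype_apply, Submodule.coe_smul, pi_eq_sum_univ' ((b i : Fin n → R)),
      Finset.smul_sum]
    refine sum_mem fun j _ => ?_
    rw [smul_smul]
    exact Submodule.smul_mem_smul (hsm _ (hmin _ (b i).2 j)) Submodule.mem_top
  have h2 := Submodule.smul_top_le_comap_smul_top (Ideal.ofList xs) (b.coord i) h1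
  simpa using h2

end Freeness

open Abelian

section TorExt

lemma exact_rTensor_iff {R : Type*} [CommRing R] {X Y W S : Type*} [AddCommGroup X] [Module R X]
    [AddCommGroup Y] [Module R Y] [AddCommGroup W] [Module R W] [AddCommGroup S] [Module R S]
    (α : X →ₗ[R] Y) (β : Y →ₗ[R] W) (h : β ∘ₗ α = 0) :
    Function.Exact (α.rTensor S) (β.rTensor S) ↔
      ∀ f : Y →ₗ[R] CharacterModule S, f ∘ₗ α = 0 → ∃ g : W →ₗ[R] CharacterModule S, g ∘ₗ β = f := by
  have hle : LinearMap.range α ≤ LinearMap.ker β := LinearMap.range_le_ker_iff.2 h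
  set βb := (LinearMap.range α).liftQ β hle with hβb
  have hβ : βb ∘ₗ (LinearMap.range α).mkQ = β := Submodule.liftQ_mkQ _ _ _
  have hex : Function.Exact (α.rTensor S) ((LinearMap.range α).mkQ.rTensor S) :=
    rTensor_exact S (LinearMap.exact_map_mkQ_range α) (Submodule.mkQ_surjective _)
  have hsurj := LinearMap.rTensor_surjective S (Submodule.mkQ_surjective (LinearMap.range α))
  have hcomp : ∀ y, β.rTensor S y = βb.rTensor S ((LinearMap.range α).mkQ.rTensor S y) := by
    intro y
    rw [← LinearMap.comp_apply, ← LinearMap.rTensor_comp, hβ]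
  have h1 : Function.Exact (α.rTensor S) (β.rTensor S) ↔ Function.Injective (βb.rTensor S) := by
    constructor
    · intro he
      rw [injective_iff_map_eq_zero]
      intro z hz
      obtain ⟨y, rfl⟩ := hsurj z
      rw [← hcomp] at hz
      exact (hex y).2 ((he y).1 hz)
    · intro hinj y
      rw [hcomp, ← hex y]
      exact ⟨fun h => hinj (h.trans (map_zero _).symm), fun h => by rw [h, map_zero]⟩
  rw [h1, rTensor_injective_iff_lcomp_surjective]
  constructor
  · intro hs f hf
    obtain ⟨g, hg⟩ := hs ((LinearMap.range α).liftQ f (LinearMap.range_le_ker_iff.2 hf))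
    refine ⟨g, ?_⟩
    have hg' : g ∘ₗ βb = (LinearMap.range α).liftQ f (LinearMap.range_le_ker_iff.2 hf) := hg
    rw [← hβ, ← LinearMap.comp_assoc, hg', Submodule.liftQ_mkQ]
  · intro hs f
    obtain ⟨g, hg⟩ := hs (f ∘ₗ (LinearMap.range α).mkQ) (by
      rw [LinearMap.comp_assoc, LinearMap.range_mkQ_comp, LinearMap.comp_zero])
    refine ⟨g, ?_⟩
    change g ∘ₗ βb = f
    refine Submodule.linearMap_qext _ ?_
    rw [LinearMap.comp_assoc, hβ, hg]

variable {R : Type u} [CommRing R]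

/-- `Tor` vanishes if and only if `Ext` into the character module vanishes. -/
theorem isZero_tor_iff (N S : ModuleCat.{u} R) (i : ℕ) :
    Limits.IsZero (((Tor' (ModuleCat.{u} R) (i + 1)).obj N).obj S) ↔
      Subsingleton (Ext.{u} N (ModuleCat.of R (CharacterModule S)) (i + 1)) := by
  let P := projectiveResolution N
  have h1 := (P.isoLeftDerivedObj ((MonoidalCategory.tensoringRight (ModuleCat.{u} R)).obj S)
    (i + 1)).isZero_iff
  have h2 : Subsingleton (Ext.{u} N (ModuleCat.of R (CharacterModule S)) (i + 1)) ↔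
      ∀ f : P.complex.X (i + 1) ⟶ ModuleCat.of R (CharacterModule S),
        P.complex.d (i + 2) (i + 1) ≫ f = 0 →
        ∃ g : P.complex.X i ⟶ ModuleCat.of R (CharacterModule S),
          P.complex.d (i + 1) i ≫ g = f := by
    constructor
    · intro hs f hf
      exact (P.extMk_eq_zero_iff f (i + 2) rfl hf i rfl).1 (Subsingleton.elim _ _)
    · intro h
      refine subsingleton_of_forall_eq 0 fun x => ?_
      obtain ⟨f, hf, rfl⟩ := P.extMk_surjective x (i + 2) rfl
      exact (P.extMk_eq_zero_iff f (i + 2) rfl hf i rfl).2 (h f hf)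
  refine h1.trans (Iff.trans ?_ h2.symm)
  have h3 := exact_rTensor_iff (S := S) (P.complex.d (i + 2) (i + 1)).hom (P.complex.d (i + 1) i).hom
    (by rw [← ModuleCat.hom_comp, HomologicalComplex.d_comp_d]; rfl)
  have h4 : Limits.IsZero ((HomologicalComplex.homologyFunctor (ModuleCat.{u} R) _ (i + 1)).obj
      ((((MonoidalCategory.tensoringRight (ModuleCat.{u} R)).obj S).mapHomologicalComplex _).obj
        P.complex)) ↔ Function.Exact ((P.complex.d (i + 2) (i + 1)).hom.rTensor S)
          ((P.complex.d (i + 1) i).hom.rTensor S) := by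
    refine (HomologicalComplex.exactAt_iff_isZero_homology _ _).symm.trans ?_
    rw [HomologicalComplex.exactAt_iff' _ (i + 2) (i + 1) i (by simp) (by simp),
      ShortComplex.ShortExact.moduleCat_exact_iff_function_exact]
    rfl
  rw [h4, h3]
  constructor
  · intro h f hf
    obtain ⟨g, hg⟩ := h f.hom (by rw [← ModuleCat.hom_comp, hf]; rfl)
    exact ⟨ModuleCat.ofHom g, ModuleCat.hom_ext hg⟩
  · intro h f hf
    obtain ⟨g, hg⟩ := h (ModuleCat.ofHom f) (ModuleCat.hom_ext hf)
    exact ⟨g.hom, by rw [← ModuleCat.hom_comp, hg]; rfl⟩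

section ExtVanishing

variable (S : Type u) [AddCommGroup S] [Module R S]

/-- The `i`-th `Ext` of `N` into the character module of `S` vanishes. -/
def ExtVanishes (i : ℕ) (N : Type u) [AddCommGroup N] [Module R N] : Prop :=
  Subsingleton (Ext.{u} (ModuleCat.of R N) (ModuleCat.of R (CharacterModule S)) i)

variable {S} {A B C : Type u} [AddCommGroup A] [Module R A] [AddCommGroup B] [Module R B]
  [AddCommGroup C] [Module R C]

lemma ExtVanishes.of_linearEquiv {i : ℕ} (e : A ≃ₗ[R] B) (h : ExtVanishes (R := R) S i A) :
    ExtVanishes (R := R) S i B := by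
  unfold ExtVanishes at h ⊢
  refine subsingleton_of_forall_eq 0 fun x => ?_
  have h1 : x = (Ext.mk₀ e.toModuleIso.inv).comp ((Ext.mk₀ e.toModuleIso.hom).comp x (zero_add i))
      (zero_add i) := by
    rw [Ext.mk₀_comp_mk₀_assoc, Iso.inv_hom_id, Ext.mk₀_id_comp]
  rw [h1, h.elim ((Ext.mk₀ e.toModuleIso.hom).comp x (zero_add i)) 0, Ext.comp_zero]

/-- The short complex of modules attached to a short exact sequence of linear maps. -/
abbrev linearShortComplex (f : A →ₗ[R] B) (g : B →ₗ[R] C) (hfg : Function.Exact f g) :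
    ShortComplex (ModuleCat.{u} R) :=
  ShortComplex.mk (ModuleCat.ofHom f) (ModuleCat.ofHom g)
    (ModuleCat.hom_ext hfg.linearMap_comp_eq_zero)

lemma linearShortComplex_shortExact {f : A →ₗ[R] B} {g : B →ₗ[R] C} (hf : Function.Injective f)
    (hfg : Function.Exact f g) (hg : Function.Surjective g) :
    (linearShortComplex f g hfg).ShortExact where
  exact := (ShortComplex.ShortExact.moduleCat_exact_iff_function_exact _).2 hfg
  mono_f := (ModuleCat.mono_iff_injective _).2 hf
  epi_g := (ModuleCat.epi_iff_surjective _).2 hg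

lemma ExtVanishes.left {f : A →ₗ[R] B} {g : B →ₗ[R] C} (hf : Function.Injective f)
    (hfg : Function.Exact f g) (hg : Function.Surjective g) {i : ℕ}
    (hB : ExtVanishes (R := R) S i B) (hC : ExtVanishes (R := R) S (i + 1) C) :
    ExtVanishes (R := R) S i A := by
  unfold ExtVanishes at hB hC ⊢
  refine subsingleton_of_forall_eq 0 fun x => ?_
  obtain ⟨y, hy⟩ := Ext.contravariant_sequence_exact₁ (linearShortComplex_shortExact hf hfg hg) _ x
    (add_comm 1 i) (hC.elim _ _)
  rw [← hy, hB.elim y 0, Ext.comp_zero]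

lemma ExtVanishes.right {f : A →ₗ[R] B} {g : B →ₗ[R] C} (hf : Function.Injective f)
    (hfg : Function.Exact f g) (hg : Function.Surjective g) {i : ℕ}
    (hA : ExtVanishes (R := R) S i A) (hB : ExtVanishes (R := R) S (i + 1) B) :
    ExtVanishes (R := R) S (i + 1) C := by
  unfold ExtVanishes at hA hB ⊢
  refine subsingleton_of_forall_eq 0 fun x => ?_
  obtain ⟨y, hy⟩ := Ext.contravariant_sequence_exact₃ (linearShortComplex_shortExact hf hfg hg) _ x
    (hB.elim _ _) (add_comm 1 i)
  rw [← hy, hA.elim y 0, Ext.comp_zero]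

lemma rTensor_injective_of_extVanishes_one {f : A →ₗ[R] B} {g : B →ₗ[R] C}
    (hf : Function.Injective f)
    (hfg : Function.Exact f g) (hg : Function.Surjective g)
    (hC : ExtVanishes (R := R) S 1 C) : Function.Injective (f.rTensor S) := by
  unfold ExtVanishes at hC
  rw [rTensor_injective_iff_lcomp_surjective]
  intro φ
  obtain ⟨y, hy⟩ := Ext.contravariant_sequence_exact₁ (linearShortComplex_shortExact hf hfg hg)
    (ModuleCat.of R (CharacterModule S)) (Ext.mk₀ (ModuleCat.ofHom φ)) (add_zero 1) (hC.elim _ _)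
  obtain ⟨ψ, rfl⟩ := (Ext.mk₀_bijective _ _).2 y
  rw [Ext.mk₀_comp_mk₀] at hy
  have h1 := (Ext.mk₀_bijective _ _).1 hy
  exact ⟨ψ.hom, congr_arg ModuleCat.Hom.hom h1⟩

lemma extVanishes_one_of_rTensor_injective {f : A →ₗ[R] B} {g : B →ₗ[R] C}
    (hf : Function.Injective f)
    (hfg : Function.Exact f g) (hg : Function.Surjective g)
    (hB : ExtVanishes (R := R) S 1 B) (h : Function.Injective (f.rTensor S)) :
    ExtVanishes (R := R) S 1 C := by
  unfold ExtVanishes at hB ⊢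
  rw [rTensor_injective_iff_lcomp_surjective] at h
  refine subsingleton_of_forall_eq 0 fun x => ?_
  have hS := linearShortComplex_shortExact hf hfg hg
  obtain ⟨y, hy⟩ := Ext.contravariant_sequence_exact₃ hS _ x (hB.elim _ _) (add_zero 1)
  obtain ⟨φ, rfl⟩ := (Ext.mk₀_bijective _ _).2 y
  obtain ⟨ψ, hψ⟩ := h φ.hom
  have h1 : φ = (linearShortComplex f g hfg).f ≫ ModuleCat.ofHom ψ := ModuleCat.hom_ext hψ.symm
  rw [← hy, h1, ← Ext.mk₀_comp_mk₀, hS.extClass_comp_assoc]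

/-- Vanishing of all higher `Ext` passes to the quotient by a sequence which is regular on the
module and on its tensor product with `S`. -/
lemma extVanishes_quotient {N : Type u} [AddCommGroup N] [Module R N] {rs : List R}
    (hN : IsWeaklyRegular N rs) (hNS : IsWeaklyRegular (N ⊗[R] S) rs)
    (h : ∀ i, ExtVanishes (R := R) S (i + 1) N) (i : ℕ) :
    ExtVanishes (R := R) S (i + 1) (N ⧸ (Ideal.ofList rs • (⊤ : Submodule R N))) := by
  induction rs generalizing N i with
  | nil =>
    refine (h i).of_linearEquiv (Submodule.quotEquivOfEqBot _ ?_).symm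
    rw [Ideal.ofList_nil, Submodule.bot_smul]
  | cons r rs ih =>
    rw [isWeaklyRegular_cons_iff] at hN hNS
    refine ExtVanishes.of_linearEquiv
      (Submodule.quotOfListConsSMulTopEquivQuotSMulTopInner N r rs).symm (ih hN.2 ?_ ?_ i)
    · exact ((QuotSMulTop.quotSMulTopTensorEquivQuotSMulTop r S N).isWeaklyRegular_congr rs).2 hNS.2
    · have hf : Function.Injective (LinearMap.lsmul R N r) := hN.1
      have hex := LinearMap.exact_lsmul_mkQ_smul_top N r
      rintro (_ | j)
      · refine extVanishes_one_of_rTensor_injective hf hex (Submodule.mkQ_surjective _) (h 0) ?_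
        have : (LinearMap.lsmul R N r).rTensor S = LinearMap.lsmul R (N ⊗[R] S) r := by
          ext; simp [TensorProduct.smul_tmul']
        rw [this]
        exact hNS.1
      · exact ExtVanishes.right hf hex (Submodule.mkQ_surjective _) (h j) (h (j + 1))

lemma extVanishes_of_projective (N : Type u) [AddCommGroup N] [Module R N] [Module.Projective R N]
    (i : ℕ) : ExtVanishes (R := R) S (i + 1) N := by
  have : Projective (ModuleCat.of R N) := (IsProjective.iff_projective N).1 inferInstance
  exact Ext.subsingleton_of_projective _ _ i

lemma isWeaklyRegular_of_subsingleton {R : Type*} [CommRing R] {N : Type*} [AddCommGroup N]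
    [Module R N] [Subsingleton N] (rs : List R) : IsWeaklyRegular N rs :=
  ⟨fun _ _ => Function.injective_of_subsingleton _⟩

section Syzygy

variable {Z G M : Type u} [AddCommGroup Z] [Module R Z] [AddCommGroup G] [Module R G]
  [AddCommGroup M] [Module R M] {f : Z →ₗ[R] G} {g : G →ₗ[R] M} {rs : List R}

/-- Reduction of a linear map modulo an ideal. -/
abbrev mapMod (I : Ideal R) (f : Z →ₗ[R] G) :
    (Z ⧸ (I • (⊤ : Submodule R Z))) →ₗ[R] G ⧸ (I • (⊤ : Submodule R G)) :=
  Submodule.mapQ _ _ f (Submodule.smul_top_le_comap_smul_top I f)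

lemma mapMod_injective (hf : Function.Injective f) (hfg : Function.Exact f g)
    (hg : Function.Surjective g) (h : IsWeaklyRegular M rs) :
    Function.Injective (mapMod (Ideal.ofList rs) f) := by
  rw [injective_iff_map_eq_zero]
  intro z hz
  obtain ⟨z, rfl⟩ := Submodule.mkQ_surjective _ z
  rw [Submodule.mkQ_apply, Submodule.mapQ_apply, Submodule.Quotient.mk_eq_zero] at hz
  rw [Submodule.mkQ_apply, Submodule.Quotient.mk_eq_zero]
  exact mem_smul_top_of_map_mem hf hfg hg h hz

lemma mapMod_exact (hfg : Function.Exact f g) (hg : Function.Surjective g) :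
    Function.Exact (mapMod (Ideal.ofList rs) f) (mapMod (Ideal.ofList rs) g) := by
  refine map_first_exact_on_four_term_right_exact_of_isSMulRegular_last (M₄ := Fin 0 → R)
    (f₃ := 0) hfg ?_ (Function.surjective_to_subsingleton _) (isWeaklyRegular_of_subsingleton rs)
  intro y
  exact ⟨fun _ => hg y, fun _ => rfl⟩

lemma mapMod_surjective (I : Ideal R) (hg : Function.Surjective g) :
    Function.Surjective (mapMod I g) := by
  intro y
  obtain ⟨y, rfl⟩ := Submodule.mkQ_surjective _ y
  obtain ⟨x, rfl⟩ := hg y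
  exact ⟨Submodule.Quotient.mk x, rfl⟩

end Syzygy

end ExtVanishing

end TorExt

section FreenessCriteria

lemma extVanishes_quotient_of_flat {R A : Type u} [CommRing R] [CommRing A] [IsLocalRing A]
    [Algebra R A] {d : ℕ} (hA : ParametersRegular (R := A) d A)
    {xs : List R} (hxl : xs.length = d) (hx : IsWeaklyRegular R xs)
    (hxm : ∀ x ∈ xs.map (algebraMap R A), x ∈ maximalIdeal A)
    (hxr : maximalIdeal A ≤ (Ideal.ofList (xs.map (algebraMap R A))).radical)
    (G : Type u) [AddCommGroup G] [Module R G] [Module.Projective R G] (i : ℕ) :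
    ExtVanishes (R := R) A (i + 1) (G ⧸ (Ideal.ofList xs • (⊤ : Submodule R G))) := by
  refine extVanishes_quotient ?_ ?_ (extVanishes_of_projective G) i
  · exact ((TensorProduct.lid R G).isWeaklyRegular_congr xs).1
      (hx.isWeaklyRegular_rTensor (M₂ := G))
  · refine IsWeaklyRegular.isWeaklyRegular_lTensor ?_
    rw [← isWeaklyRegular_map_algebraMap_iff A]
    exact hA _ (by simpa using hxl) hxm hxr

lemma length_quotient_congr {R : Type*} [CommRing R] {K L : Type*} [AddCommGroup K] [Module R K]
    [AddCommGroup L] [Module R L] (e : K ≃ₗ[R] L) (I : Ideal R) :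
    Module.length R (K ⧸ (I • (⊤ : Submodule R K))) =
      Module.length R (L ⧸ (I • (⊤ : Submodule R L))) :=
  (Submodule.Quotient.equiv _ _ e (by
    rw [Submodule.map_smul'', Submodule.map_top, LinearEquiv.range])).length_eq

lemma exists_baseChange_rank_maps {R A M : Type u} [CommRing R] [CommRing A]
    [Algebra R A] [AddCommGroup M] [Module R M] {r : ℕ} {c : R}
    (u : (Fin r → R) →ₗ[R] M) (v : M →ₗ[R] (Fin r → R)) (hvu : ∀ a, v (u a) = c • a)
    (huv : ∀ x, u (v x) = c • x) :
    ∃ (u' : (Fin r → A) →ₗ[A] A ⊗[R] M) (v' : A ⊗[R] M →ₗ[A] (Fin r → A)),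
      (∀ a, v' (u' a) = algebraMap R A c • a) ∧ ∀ x, u' (v' x) = algebraMap R A c • x := by
  let e := TensorProduct.piScalarRight R A A (Fin r)
  have key : ∀ {N : Type u} [AddCommGroup N] [Module R N] (x : A ⊗[R] N),
      (c • (LinearMap.id : N →ₗ[R] N)).baseChange A x = algebraMap R A c • x := by
    intro N _ _ x
    rw [LinearMap.baseChange_smul, LinearMap.baseChange_id, LinearMap.smul_apply,
      LinearMap.id_apply, algebraMap_smul]
  have h1 : v ∘ₗ u = c • LinearMap.id := LinearMap.ext hvu
  have h2 : u ∘ₗ v = c • LinearMap.id := LinearMap.ext huv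
  refine ⟨u.baseChange A ∘ₗ e.symm.toLinearMap, e.toLinearMap ∘ₗ v.baseChange A, ?_, ?_⟩
  · intro a
    have h3 : v.baseChange A (u.baseChange A (e.symm a)) = algebraMap R A c • e.symm a := by
      rw [← LinearMap.comp_apply, ← LinearMap.baseChange_comp, h1, key]
    change e (v.baseChange A (u.baseChange A (e.symm a))) = _
    rw [h3, map_smul, e.apply_symm_apply]
  · intro x
    change u.baseChange A (e.symm (e (v.baseChange A x))) = _
    rw [e.symm_apply_apply, ← LinearMap.comp_apply, ← LinearMap.baseChange_comp, h2, key]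

variable {R : Type u} [CommRing R] [IsLocalRing R]
  {A : Type u} [CommRing A] [IsLocalRing A] [IsNoetherianRing A] [Algebra R A]

/-- Vanishing of a single higher `Ext` of `M / xM` against the dual of `A` forces `M` to be free. -/
theorem free_of_extVanishes [IsNoetherianRing R] [IsLocalHom (algebraMap R A)] {d : ℕ}
    (hdim : ringKrullDim A = d)
    (hR : ParametersRegular (R := R) d R) (hA : ParametersRegular (R := A) d A)
    {xs : List R} (hxl : xs.length = d) (hxm : ∀ x ∈ xs, x ∈ maximalIdeal R)
    (hxr : maximalIdeal R ≤ (Ideal.ofList xs).radical)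
    (hxm' : ∀ x ∈ xs.map (algebraMap R A), x ∈ maximalIdeal A)
    (hxr' : maximalIdeal A ≤ (Ideal.ofList (xs.map (algebraMap R A))).radical)
    {ys : List A} (hyl : ys.length = d) (hym : ∀ y ∈ ys, y ∈ maximalIdeal A)
    (hyr : maximalIdeal A ≤ (Ideal.ofList ys).radical)
    (hy : (maximalIdeal R).map (algebraMap R A) ≤ Ideal.ofList ys)
    (i : ℕ) (M : Type u) [AddCommGroup M] [Module R M] [Module.Finite R M]
    (hM : ParametersRegular (R := R) d M)
    (h : ExtVanishes (R := R) A (i + 1) (M ⧸ (Ideal.ofList xs • (⊤ : Submodule R M)))) :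
    Module.Free R M := by
  induction i generalizing M with
  | zero =>
    obtain ⟨n, π, hπ, hmin⟩ := exists_minimal_cover (R := R) M
    have hex := LinearMap.exact_subtype_ker_map π
    have hinj := rTensor_injective_of_extVanishes_one
      (mapMod_injective (Submodule.subtype_injective _) hex hπ (hM xs hxl hxm hxr))
      (mapMod_exact hex hπ) (mapMod_surjective _ hπ) h
    rw [← LinearMap.lTensor_inj_iff_rTensor_inj] at hinj
    have := injective_of_injective_baseChange_mod hdim hA hπ hmin hxl hxm' hxr' hyl hym hyr hy hinj
    exact Module.Free.of_equiv (LinearEquiv.ofBijective π ⟨this, hπ⟩)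
  | succ i ih =>
    obtain ⟨n, π, hπ, hmin⟩ := exists_minimal_cover (R := R) M
    have hex := LinearMap.exact_subtype_ker_map π
    have hx := hM xs hxl hxm hxr
    have hZ := ExtVanishes.left
      (mapMod_injective (Submodule.subtype_injective _) hex hπ hx)
      (mapMod_exact hex hπ) (mapMod_surjective _ hπ)
      (extVanishes_quotient_of_flat hA hxl (hR xs hxl hxm hxr) hxm' hxr' (Fin n → R) i) h
    have := ih (LinearMap.ker π) (fun bs hl hm hr =>
      isWeaklyRegular_of_exact (Submodule.subtype_injective _) hex hπ
        (hR.of_flat (Fin n → R) bs hl hm hr) (hM bs hl hm hr)) hZ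
    have := injective_of_free_ker hπ hmin hxm hxr hx
    exact Module.Free.of_equiv (LinearEquiv.ofBijective π ⟨this, hπ⟩)

/-- If a system of parameters is regular on the base change of a module with a rank, and the
maximal ideal expands into a parameter ideal, then the module is free. -/
theorem free_of_isWeaklyRegular_baseChange {d : ℕ} (hdim : ringKrullDim A = d)
    {M : Type u} [AddCommGroup M] [Module R M] [Module.Finite R M]
    {r : ℕ} {c : R} (hc : c ∈ nonZeroDivisors R) (hcA : algebraMap R A c ∈ nonZeroDivisors A)
    (u : (Fin r → R) →ₗ[R] M) (v : M →ₗ[R] (Fin r → R)) (hvu : ∀ a, v (u a) = c • a)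
    (huv : ∀ x, u (v x) = c • x)
    {xs : List A} (hxl : xs.length = d) (hxm : ∀ x ∈ xs, x ∈ maximalIdeal A)
    (hx : IsWeaklyRegular (A ⊗[R] M) xs)
    {ys : List A} (hyl : ys.length = d) (hym : ∀ y ∈ ys, y ∈ maximalIdeal A)
    (hyr : maximalIdeal A ≤ (Ideal.ofList ys).radical)
    (hy : (maximalIdeal R).map (algebraMap R A) ≤ Ideal.ofList ys) :
    Module.Free R M := by
  have hreg : ∀ {B : Type u} [CommRing B] {b : B} (_ : b ∈ nonZeroDivisors B) {k : ℕ}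
      {a : Fin k → B}, b • a = 0 → a = 0 := by
    intro B _ b hb k a ha
    funext i
    exact (mem_nonZeroDivisors_iff.1 hb).1 _ (congr_fun ha i)
  obtain ⟨n, π, hπ, hmin⟩ := exists_minimal_cover (R := R) M
  have hinj := baseChange_injective_of_isWeaklyRegular hdim hπ hmin hxl hxm hx hyl hym hyr hy
  obtain ⟨u', v', -, huv'⟩ := exists_baseChange_rank_maps (A := A) u v hvu huv
  let e := TensorProduct.piScalarRight R A A (Fin n)
  have h1 : n ≤ r := by
    refine le_of_fin_injective A (v' ∘ₗ π.baseChange A ∘ₗ e.symm.toLinearMap) ?_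
    rw [injective_iff_map_eq_zero]
    intro a ha
    refine hreg hcA ?_
    have h2 := huv' (π.baseChange A (e.symm a))
    rw [show v' (π.baseChange A (e.symm a)) = 0 from ha, map_zero, ← map_smul, ← map_smul] at h2
    have h3 := hinj (h2.symm.trans (map_zero _).symm)
    rwa [map_smul, ← map_smul e.symm, LinearEquiv.map_eq_zero_iff] at h3
  have hu : Function.Injective u := by
    rw [injective_iff_map_eq_zero]
    intro a ha
    refine hreg hc ?_
    rw [← hvu, ha, map_zero]
  have h2 : r ≤ n := by
    obtain ⟨w, hw⟩ := Module.projective_lifting_property π u hπ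
    refine le_of_fin_injective R w ?_
    refine Function.Injective.of_comp (f := π) ?_
    rw [← LinearMap.coe_comp, hw]
    exact hu
  obtain rfl : n = r := le_antisymm h1 h2
  have h3 := OrzechProperty.injective_of_surjective_of_injective u π hu hπ
  exact Module.Free.of_equiv (LinearEquiv.ofBijective π ⟨h3, hπ⟩)

end FreenessCriteria

section Depth

variable {R : Type u} [CommRing R] [IsLocalRing R]

lemma exists_isWeaklyRegular_of_depth_eq {d : ℕ} (hd : 0 < d) {M : Type u} [AddCommGroup M]
    [Module R M] (h : (depth R M : WithBot ℕ∞) = d) :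
    ∃ rs : List R, rs.length = d ∧ (∀ r ∈ rs, r ∈ maximalIdeal R) ∧ IsWeaklyRegular M rs := by
  have h1 : depth R M = d := by exact_mod_cast h
  have h2 : ((d - 1 : ℕ) : ℕ∞) < depth R M := by
    rw [h1]
    exact_mod_cast Nat.sub_lt hd one_pos
  obtain ⟨rs, h3⟩ := lt_iSup_iff.1 h2
  obtain ⟨⟨hreg, hm⟩, h4⟩ := lt_iSup_iff.1 h3
  have h5 : d - 1 < rs.length := by exact_mod_cast h4
  have h6 := hreg.toIsWeaklyRegular
  rw [← List.take_append_drop d rs, isWeaklyRegular_append_iff] at h6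
  exact ⟨rs.take d, by rw [List.length_take]; omega,
    fun r hr => hm r (List.mem_of_mem_take hr), h6.1⟩

lemma parametersRegular_of_depth_eq [IsNoetherianRing R] {d : ℕ} (hd : 0 < d)
    (hdim : ringKrullDim R = d) {M : Type u} [AddCommGroup M] [Module R M] [Module.Finite R M]
    (h : (depth R M : WithBot ℕ∞) = ringKrullDim R) : ParametersRegular (R := R) d M := by
  obtain ⟨rs, hl, hm, hrs⟩ := exists_isWeaklyRegular_of_depth_eq hd (h.trans hdim)
  exact ParametersRegular.of_isWeaklyRegular hdim hl hm hrs

end Depth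

section Parameters

variable {R : Type u} [CommRing R]

lemma ofList_ofFn {d : ℕ} (x : Fin d → R) :
    Ideal.ofList (List.ofFn x) = Ideal.span (Set.range x) := by
  unfold Ideal.ofList
  congr 1
  ext r
  simp [List.mem_ofFn]

variable [IsLocalRing R] {d : ℕ} {x : Fin d → R}

lemma IsSystemOfParameters.mem_maximalIdeal (hx : IsSystemOfParameters x) :
    ∀ a ∈ List.ofFn x, a ∈ maximalIdeal R := by
  intro a ha
  rw [← hx.radical_eq, ← ofList_ofFn]
  exact Ideal.le_radical (mem_ofList ha)

lemma IsSystemOfParameters.le_radical (hx : IsSystemOfParameters x) :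
    maximalIdeal R ≤ (Ideal.ofList (List.ofFn x)).radical := by
  rw [ofList_ofFn, hx.radical_eq]

lemma IsSystemOfParameters.exists_frobeniusPower_le [IsNoetherianRing R]
    (hx : IsSystemOfParameters x) (p : ℕ) [Fact p.Prime] :
    ∃ t, frobeniusPower p t (maximalIdeal R) ≤ Ideal.span (Set.range x) := by
  obtain ⟨N, hN⟩ := Ideal.exists_radical_pow_le_of_fg (Ideal.span (Set.range x))
    (IsNoetherian.noetherian _)
  rw [hx.radical_eq] at hN
  refine ⟨N, Ideal.span_le.2 ?_⟩
  rintro _ ⟨r, hr, rfl⟩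
  exact hN (Ideal.pow_le_pow_right (Nat.lt_pow_self (Fact.out : p.Prime).one_lt).le
    (Ideal.pow_mem_pow hr _))

/-- For `n ≥ κ(R)`, the `p ^ n`-th powers of the elements of the maximal ideal lie in a
parameter ideal. -/
lemma exists_parameters_of_kappa_le [IsNoetherianRing R] (hx : IsSystemOfParameters x) {p : ℕ}
    [Fact p.Prime] {n : ℕ} (hn : kappa R p ≤ n) :
    ∃ ys : List R, ys.length = d ∧ (∀ y ∈ ys, y ∈ maximalIdeal R) ∧
      maximalIdeal R ≤ (Ideal.ofList ys).radical ∧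
      ∀ r ∈ maximalIdeal R, r ^ p ^ n ∈ Ideal.ofList ys := by
  obtain ⟨t, ht⟩ := hx.exists_frobeniusPower_le p
  obtain ⟨d', y, hy, hle⟩ := Nat.sInf_mem (s := {t : ℕ | ∃ (d : ℕ) (x : Fin d → R),
    IsSystemOfParameters x ∧ frobeniusPower p t (maximalIdeal R) ≤ Ideal.span (Set.range x)})
    ⟨t, d, x, hx, ht⟩
  have hd : d' = d := by exact_mod_cast hy.dim_eq.symm.trans hx.dim_eq
  refine ⟨List.ofFn y, by rw [List.length_ofFn, hd], hy.mem_maximalIdeal, hy.le_radical, ?_⟩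
  intro r hr
  rw [ofList_ofFn]
  have h1 : r ^ p ^ kappa R p ∈ Ideal.span (Set.range y) := hle (Ideal.subset_span ⟨r, hr, rfl⟩)
  exact Ideal.mem_of_dvd _ (pow_dvd_pow r (Nat.pow_le_pow_right (Fact.out : p.Prime).pos hn)) h1

end Parameters

section FrobeniusAlgebra

/-- The ring `R` as an algebra over itself via the `n`-th iterate of Frobenius. -/
def FrobeniusAlgebra (R : Type u) (_p _n : ℕ) : Type u := R

variable (R : Type u) [CommRing R] (p n : ℕ)

instance : CommRing (FrobeniusAlgebra R p n) := inferInstanceAs (CommRing R)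

instance [IsLocalRing R] : IsLocalRing (FrobeniusAlgebra R p n) :=
  inferInstanceAs (IsLocalRing R)

instance [IsNoetherianRing R] : IsNoetherianRing (FrobeniusAlgebra R p n) :=
  inferInstanceAs (IsNoetherianRing R)

variable {R} in
lemma ParametersRegular.frobeniusAlgebra [IsLocalRing R] {d : ℕ}
    (hR : ParametersRegular (R := R) d R) :
    ParametersRegular (R := FrobeniusAlgebra R p n) d (FrobeniusAlgebra R p n) := hR

variable [ExpChar R p]

instance : Algebra R (FrobeniusAlgebra R p n) := (iterateFrobenius R p n).toAlgebra

lemma length_frobeniusFunctor (N : Type u) [AddCommGroup N] [Module R N] :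
    Module.length R ((frobeniusFunctor p n).obj (ModuleCat.of R N)) =
      Module.length (FrobeniusAlgebra R p n) (FrobeniusAlgebra R p n ⊗[R] N) := rfl

variable {R}

instance : IsLocalHom (algebraMap R (FrobeniusAlgebra R p n)) where
  map_nonunit a ha :=
    (isUnit_pow_iff (pow_pos (expChar_pos R p) n).ne').1 (show IsUnit (a ^ p ^ n : R) from ha)

lemma algebraMap_mem_nonZeroDivisors {c : R} (hc : c ∈ nonZeroDivisors R) :
    algebraMap R (FrobeniusAlgebra R p n) c ∈ nonZeroDivisors (FrobeniusAlgebra R p n) :=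
  pow_mem hc (p ^ n)

lemma length_frobeniusFunctor_quotient (xs : List R) (M : Type u) [AddCommGroup M] [Module R M] :
    Module.length R ((frobeniusFunctor p n).obj
      (ModuleCat.of R (M ⧸ (Ideal.ofList xs • (⊤ : Submodule R M))))) =
    Module.length (FrobeniusAlgebra R p n) ((FrobeniusAlgebra R p n ⊗[R] M) ⧸
      (Ideal.ofList (xs.map (algebraMap R (FrobeniusAlgebra R p n))) •
        (⊤ : Submodule (FrobeniusAlgebra R p n) (FrobeniusAlgebra R p n ⊗[R] M)))) := by
  rw [length_frobeniusFunctor, ← (baseChangeQuotientEquiv (FrobeniusAlgebra R p n) _ M).length_eq,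
    Ideal.map_ofList]

lemma isZero_frobeniusTor_iff (i : ℕ) (N : Type u) [AddCommGroup N] [Module R N] :
    Limits.IsZero (frobeniusTor p (i + 1) n (ModuleCat.of R N)) ↔
      ExtVanishes (R := R) (FrobeniusAlgebra R p n) (i + 1) N :=
  isZero_tor_iff (ModuleCat.of R N) (frobeniusModule R p n) i

variable [IsLocalRing R] {xs : List R}

lemma map_algebraMap_mem_maximalIdeal (hm : ∀ b ∈ xs, b ∈ maximalIdeal R) :
    ∀ b ∈ xs.map (algebraMap R (FrobeniusAlgebra R p n)),
      b ∈ maximalIdeal (FrobeniusAlgebra R p n) := by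
  intro b hb
  obtain ⟨a, ha, rfl⟩ := List.mem_map.1 hb
  exact map_maximalIdeal_le (Ideal.mem_map_of_mem _ (hm a ha))

lemma maximalIdeal_le_radical_map_algebraMap
    (hrad : maximalIdeal R ≤ (Ideal.ofList xs).radical) :
    maximalIdeal (FrobeniusAlgebra R p n) ≤
      (Ideal.ofList (xs.map (algebraMap R (FrobeniusAlgebra R p n)))).radical :=
  maximalIdeal_le_radical_of_forall (R := R) (bs := xs.map (· ^ p ^ n)) hrad fun a ha =>
    ⟨p ^ n, mem_ofList (List.mem_map.2 ⟨a, ha, rfl⟩)⟩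

lemma length_quotient_frobeniusAlgebra {d : ℕ} (hR : ParametersRegular (R := R) d R)
    (hl : xs.length = d) (hm : ∀ b ∈ xs, b ∈ maximalIdeal R)
    (hrad : maximalIdeal R ≤ (Ideal.ofList xs).radical) :
    Module.length (FrobeniusAlgebra R p n) (FrobeniusAlgebra R p n ⧸
      (Ideal.ofList (xs.map (algebraMap R (FrobeniusAlgebra R p n))) •
        (⊤ : Submodule (FrobeniusAlgebra R p n) (FrobeniusAlgebra R p n)))) =
      ((p ^ n) ^ d : ℕ) * Module.length R (R ⧸ (Ideal.ofList xs • (⊤ : Submodule R R))) :=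
  length_quotient_ofList_pow_eq hR hl hm hrad (pow_pos (expChar_pos R p) n)

lemma not_isZero_frobeniusTor_zero (N : Type u) [AddCommGroup N] [Module R N] [Module.Finite R N]
    [Nontrivial N] : ¬ Limits.IsZero (frobeniusTor p 0 n (ModuleCat.of R N)) := by
  intro h
  have e := (Functor.leftDerivedZeroIsoSelf
    ((MonoidalCategory.tensoringRight (ModuleCat.{u} R)).obj (frobeniusModule R p n))).app
      (ModuleCat.of R N)
  have h1 : Limits.IsZero (ModuleCat.of R (N ⊗[R] FrobeniusAlgebra R p n)) := h.of_iso e.symm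
  have h2 : Subsingleton (N ⊗[R] FrobeniusAlgebra R p n) := ModuleCat.subsingleton_of_isZero h1
  have h3 : Subsingleton (FrobeniusAlgebra R p n ⊗[R] N) :=
    (TensorProduct.comm R (FrobeniusAlgebra R p n) N).toEquiv.subsingleton
  have := subsingleton_of_subsingleton_baseChange h3
  exact not_subsingleton N this

end FrobeniusAlgebra

section Main

variable {R : Type u} [CommRing R] [IsLocalRing R] {p : ℕ} [ExpChar R p]
  {M : Type u} [AddCommGroup M] [Module R M] {xs : List R}

lemma length_frobeniusFunctor_quotient_of_free {d : ℕ}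
    (hR : ParametersRegular (R := R) d R) (hl : xs.length = d)
    (hm : ∀ b ∈ xs, b ∈ maximalIdeal R) (hrad : maximalIdeal R ≤ (Ideal.ofList xs).radical)
    [Module.Finite R M] [Module.Free R M] (n : ℕ) :
    Module.length R ((frobeniusFunctor p n).obj
      (ModuleCat.of R (M ⧸ (Ideal.ofList xs • (⊤ : Submodule R M))))) =
    ((p ^ n) ^ d : ℕ) * Module.length R (M ⧸ (Ideal.ofList xs • (⊤ : Submodule R M))) := by
  let e : M ≃ₗ[R] (Fin (Module.finrank R M) → R) := (Module.finBasis R M).equivFun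
  rw [length_frobeniusFunctor_quotient, length_quotient_congr e, length_pi_quotient,
    length_quotient_congr (e.baseChange R (FrobeniusAlgebra R p n) _ _ ≪≫ₗ
      TensorProduct.piScalarRight R (FrobeniusAlgebra R p n) (FrobeniusAlgebra R p n) _),
    length_pi_quotient, length_quotient_frobeniusAlgebra p n hR hl hm hrad]
  ring

lemma free_of_length_frobeniusFunctor_eq [IsNoetherianRing R] [Module.Finite R M] {d : ℕ}
    (hd : 0 < d) (hdim : ringKrullDim R = d)
    (hR : ParametersRegular (R := R) d R) (hM : ParametersRegular (R := R) d M)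
    (hrank : HasRank R M) (hl : xs.length = d)
    (hm : ∀ b ∈ xs, b ∈ maximalIdeal R) (hrad : maximalIdeal R ≤ (Ideal.ofList xs).radical)
    {n : ℕ} {ys : List R} (hyl : ys.length = d) (hym : ∀ y ∈ ys, y ∈ maximalIdeal R)
    (hyr : maximalIdeal R ≤ (Ideal.ofList ys).radical)
    (hy : ∀ r ∈ maximalIdeal R, r ^ p ^ n ∈ Ideal.ofList ys)
    (h : Module.length R ((frobeniusFunctor p n).obj
        (ModuleCat.of R (M ⧸ (Ideal.ofList xs • (⊤ : Submodule R M))))) =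
      ((p ^ n) ^ d : ℕ) * Module.length R (M ⧸ (Ideal.ofList xs • (⊤ : Submodule R M)))) :
    Module.Free R M := by
  obtain ⟨r, ⟨g⟩⟩ := hrank
  obtain ⟨c, hc, u, v, hvu, huv⟩ := exists_rank_maps g
  obtain ⟨e, rfl⟩ := Nat.exists_eq_succ_of_ne_zero hd.ne'
  have hdim' : ringKrullDim (FrobeniusAlgebra R p n) = (e + 1 : ℕ) := hdim
  obtain ⟨u', v', hvu', -⟩ := exists_baseChange_rank_maps (A := FrobeniusAlgebra R p n) u v hvu huv
  have hl' : (xs.map (algebraMap R (FrobeniusAlgebra R p n))).length = e + 1 := by simpa using hl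
  have hm' := map_algebraMap_mem_maximalIdeal p n hm
  have hcA := algebraMap_mem_nonZeroDivisors p n hc
  rw [length_frobeniusFunctor_quotient, length_eq_rank_mul hdim hR hM hl hm hrad hc u v hvu huv,
    mul_left_comm, ← length_quotient_frobeniusAlgebra p n hR hl hm hrad] at h
  have hreg := isWeaklyRegular_of_length_eq_rank_mul hdim' (hR.frobeniusAlgebra p n) hl' hm'
    (maximalIdeal_le_radical_map_algebraMap p n hrad) hcA u' v' hvu' h
  exact free_of_isWeaklyRegular_baseChange (A := FrobeniusAlgebra R p n) (ys := ys) hdim' hc hcA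
    u v hvu huv hl' hm' hreg hyl hym hyr (Ideal.map_le_iff_le_comap.2 hy)

lemma isZero_frobeniusTor_of_free {d : ℕ}
    (hR : ParametersRegular (R := R) d R) (hl : xs.length = d)
    (hm : ∀ b ∈ xs, b ∈ maximalIdeal R) (hrad : maximalIdeal R ≤ (Ideal.ofList xs).radical)
    [Module.Free R M] (i n : ℕ) :
    Limits.IsZero (frobeniusTor p (i + 1) n
      (ModuleCat.of R (M ⧸ (Ideal.ofList xs • (⊤ : Submodule R M))))) :=
  (isZero_frobeniusTor_iff p n i _).2 <|
    extVanishes_quotient_of_flat (hR.frobeniusAlgebra p n) hl (hR xs hl hm hrad)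
      (map_algebraMap_mem_maximalIdeal p n hm) (maximalIdeal_le_radical_map_algebraMap p n hrad) M i

lemma free_of_isZero_frobeniusTor [IsNoetherianRing R] [Module.Finite R M] {d : ℕ}
    (hdim : ringKrullDim R = d)
    (hR : ParametersRegular (R := R) d R) (hM : ParametersRegular (R := R) d M)
    (hl : xs.length = d)
    (hm : ∀ b ∈ xs, b ∈ maximalIdeal R) (hrad : maximalIdeal R ≤ (Ideal.ofList xs).radical)
    {n : ℕ} {ys : List R} (hyl : ys.length = d) (hym : ∀ y ∈ ys, y ∈ maximalIdeal R)
    (hyr : maximalIdeal R ≤ (Ideal.ofList ys).radical)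
    (hy : ∀ r ∈ maximalIdeal R, r ^ p ^ n ∈ Ideal.ofList ys) {i : ℕ}
    (h : Limits.IsZero (frobeniusTor p (i + 1) n
      (ModuleCat.of R (M ⧸ (Ideal.ofList xs • (⊤ : Submodule R M)))))) :
    Module.Free R M := by
  have hdim' : ringKrullDim (FrobeniusAlgebra R p n) = d := hdim
  exact free_of_extVanishes (A := FrobeniusAlgebra R p n) (ys := ys) hdim' hR (hR.frobeniusAlgebra p n)
    hl hm hrad (map_algebraMap_mem_maximalIdeal p n hm)
    (maximalIdeal_le_radical_map_algebraMap p n hrad) hyl hym hyr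
    (Ideal.map_le_iff_le_comap.2 hy) i M hM ((isZero_frobeniusTor_iff p n i _).1 h)

lemma nontrivial_quotient [Module.Finite R M] [Nontrivial M] (hm : ∀ b ∈ xs, b ∈ maximalIdeal R) :
    Nontrivial (M ⧸ (Ideal.ofList xs • (⊤ : Submodule R M))) := by
  by_contra h
  rw [not_nontrivial_iff_subsingleton, Submodule.Quotient.subsingleton_iff] at h
  exact not_subsingleton M (subsingleton_of_le_smul_top (Ideal.span_le.2 hm) h.ge)

lemma projectiveDimension_quotient_lt_top [IsNoetherianRing R] [Module.Finite R M] {d : ℕ}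
    (hR : ParametersRegular (R := R) d R) (hl : xs.length = d)
    (hm : ∀ b ∈ xs, b ∈ maximalIdeal R) (hrad : maximalIdeal R ≤ (Ideal.ofList xs).radical)
    [Nontrivial M] [Module.Free R M] :
    projectiveDimension (ModuleCat.of R (M ⧸ (Ideal.ofList xs • (⊤ : Submodule R M)))) < ⊤ := by
  have hP : Projective (ModuleCat.of R M) := (IsProjective.iff_projective M).1 inferInstance
  have : Nontrivial (ModuleCat.of R M) := ‹Nontrivial M›
  have : Module.Finite R (ModuleCat.of R M) := ‹Module.Finite R M›
  have h := ModuleCat.projectiveDimension_quotient_eq_add_length_of_isWeaklyRegular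
    (ModuleCat.of R M) xs (hR.of_flat M xs hl hm hrad) hm
  refine lt_of_eq_of_lt h ?_
  rw [ModuleCat.projectiveDimension_eq_zero_of_projective, zero_add]
  exact WithBot.coe_lt_coe.2 (ENat.natCast_lt_top _)

end Main

end FrobeniusFreeness

open FrobeniusFreeness

theorem corollary2p9 {R : Type u} [CommRing R] [IsLocalRing R] [IsNoetherianRing R]
    (p : ℕ) [Fact p.Prime] [CharP R p]
    (hR : FrobeniusFreeness.IsCohenMacaulayLocal R)
    (d : ℕ) (hd : 0 < d) (hdim : ringKrullDim R = d)
    (M : Type u) [AddCommGroup M] [Module R M] [Module.Finite R M]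
    (hM : FrobeniusFreeness.IsMaximalCohenMacaulay R M)
    (hrank : FrobeniusFreeness.HasRank R M)
    (x : Fin d → R) (hx : FrobeniusFreeness.IsSystemOfParameters x) :
    List.TFAE [
      -- `M` is free
      Module.Free R M,
      -- the length equality holds for one `n ≥ κ(R)`
      ∃ n ≥ FrobeniusFreeness.kappa R p,
        Module.length R ((FrobeniusFreeness.frobeniusFunctor p n).obj
            (ModuleCat.of R (FrobeniusFreeness.QuotientBy x M))) =
          (((p ^ n) ^ d : ℕ) : ℕ∞) * Module.length R (FrobeniusFreeness.QuotientBy x M),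
      -- the length equality holds for all `n`
      ∀ n : ℕ,
        Module.length R ((FrobeniusFreeness.frobeniusFunctor p n).obj
            (ModuleCat.of R (FrobeniusFreeness.QuotientBy x M))) =
          (((p ^ n) ^ d : ℕ) : ℕ∞) * Module.length R (FrobeniusFreeness.QuotientBy x M),
      -- all higher Tor modules against Frobenius vanish
      ∀ i n : ℕ, 0 < i → 0 < n →
        Limits.IsZero (FrobeniusFreeness.frobeniusTor p i n
          (ModuleCat.of R (FrobeniusFreeness.QuotientBy x M))),
      -- one higher Tor module against Frobenius vanishes, for one `n ≥ κ(R)`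
      ∃ i n : ℕ, 0 < i ∧ FrobeniusFreeness.kappa R p ≤ n ∧
        Limits.IsZero (FrobeniusFreeness.frobeniusTor p i n
          (ModuleCat.of R (FrobeniusFreeness.QuotientBy x M)))] ∧
    FrobeniusFreeness.RigidAgainstFrobenius p
      (ModuleCat.of R (FrobeniusFreeness.QuotientBy x M)) := by
  have hRreg : ParametersRegular (R := R) d R := parametersRegular_of_depth_eq hd hdim hR
  have hMreg : ParametersRegular (R := R) d M := parametersRegular_of_depth_eq hd hdim hM.depth_eq
  have hl : (List.ofFn x).length = d := List.length_ofFn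
  have hm := hx.mem_maximalIdeal
  have hrad := hx.le_radical
  have hnt : Nontrivial M := hM.nontrivial
  unfold QuotientBy
  rw [← ofList_ofFn x]
  have h51 : ∀ i n : ℕ, 0 < i → kappa R p ≤ n →
      Limits.IsZero (frobeniusTor p i n
        (ModuleCat.of R (M ⧸ (Ideal.ofList (List.ofFn x) • (⊤ : Submodule R M))))) →
      Module.Free R M := by
    intro i n hi hn h
    obtain ⟨j, rfl⟩ := Nat.exists_eq_succ_of_ne_zero hi.ne'
    obtain ⟨ys, hyl, hym, hyr, hy⟩ := exists_parameters_of_kappa_le hx hn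
    exact free_of_isZero_frobeniusTor hdim hRreg hMreg hl hm hrad hyl hym hyr hy h
  refine ⟨?_, ?_⟩
  · tfae_have 1 → 3 := fun _ n => length_frobeniusFunctor_quotient_of_free hRreg hl hm hrad n
    tfae_have 3 → 2 := fun h => ⟨_, le_rfl, h _⟩
    tfae_have 2 → 1 := by
      rintro ⟨n, hn, h⟩
      obtain ⟨ys, hyl, hym, hyr, hy⟩ := exists_parameters_of_kappa_le hx hn
      exact free_of_length_frobeniusFunctor_eq hd hdim hRreg hMreg hrank hl hm hrad hyl hym hyr hy h
    tfae_have 1 → 4 := by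
      intro _ i n hi _
      obtain ⟨j, rfl⟩ := Nat.exists_eq_succ_of_ne_zero hi.ne'
      exact isZero_frobeniusTor_of_free hRreg hl hm hrad j n
    tfae_have 4 → 5 := fun h =>
      ⟨1, kappa R p + 1, one_pos, Nat.le_succ _, h _ _ one_pos (Nat.succ_pos _)⟩
    tfae_have 5 → 1 := fun ⟨i, n, hi, hn, h⟩ => h51 i n hi hn h
    tfae_finish
  · by_cases hfree : Module.Free R M
    · exact Or.inl (projectiveDimension_quotient_lt_top hRreg hl hm hrad)
    · refine Or.inr ⟨kappa R p, fun n hn i => ?_⟩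
      rcases Nat.eq_zero_or_pos i with rfl | hi
      · have := nontrivial_quotient (M := M) hm
        exact not_isZero_frobeniusTor_zero p n _
      · exact fun h => hfree (h51 i n hi hn h)
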